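/- Conventions. A $3$-manifold is a smooth, Hausdorff, second countable $3$-dimensional manifold without boundary, possibly empty, disconnected or noncompact; it is closed if it is compact. Orientability is not assumed. Let $M, M'$ be $3$-manifolds and let $\mathcal S$ be a locally finite collection of pairwise disjoint, smoothly embedded $2$-spheres in $M$, each with a tubular neighbourhood diffeomorphic to $S^2\times(-\delta,\delta)$. We say that $M'$ is obtained from $M$ by splitting along $\mathcal S$ and capping off $3$-balls if $M'$ is a disjoint union of an open submanifold identified by a diffeomorphism $e$ with $M\setminus\bigcup\mathcal S$ and of a collection $\mathcal B$ of pairwise disjoint closed $3$-balls, such that each $S\in\mathcal S$ has a tubular neighbourhood $V\cong S^2\times(-\delta,\delta)$ meeting no other sphere of $\mathcal S$ whose two halves $V_-,V_+$ (the components of $V\setminus S$) are capped off by balls $B_-,B_+\in\mathcal B$: for each sign, $e(V_\pm)\cup B_\pm$ is an open $3$-ball of $M'$, the image of a round open ball of radius $1+\delta$ under a diffeomorphism carrying the closed unit ball to $B_\pm$ and matching the collar $S^2\times(0,\delta)$ of the unit ball with $V_\pm\cong S^2\times(0,\delta)$ (with $S$ at $0$) through some self-diffeomorphism of $S^2$;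 and every ball of $\mathcal B$ arises in this way. Let $\mathcal X$ be a class of closed $3$-manifolds. A $3$-manifold is a (possibly infinite) connected sum of members of $\mathcal X$ if it contains a locally finite collection $\mathcal S$ of pairwise disjoint embedded $2$-spheres such that splitting along $\mathcal S$ and capping off $3$-balls yields a disjoint union of $3$-manifolds, each diffeomorphic to a member of $\mathcal X$. Proposition. Let $\mathcal X$ be a class of closed $3$-manifolds and let $M$ be a $3$-manifold. Suppose that there is a finite sequence of $3$-manifolds $M_0, M_1,\dots,M_p$ such that $M_0=M$, $M_p=\emptyset$, and for each $1\le i\le p$ the manifold $M_i$ is obtained from $M_{i-1}$ by splitting along a locally finite collection of pairwise disjoint embedded $2$-spheres, capping off $3$-balls, and removing some (possibly none, possibly infinitely many) connected components, each of which is a connected sum of members of $\mathcal X$. Then each connected component of $M$ is a connected sum of members of $\mathcal X$. -/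

import Mathlib

open Set Metric
open scoped Manifold ContDiff

universe u

noncomputable section

/-- Smooth `3`-manifolds: Hausdorff, second countable, without boundary, possibly empty, possibly
disconnected, possibly noncompact. -/
structure ThreeManifold : Type (u + 1) where
  carrier : Type u
  [top : TopologicalSpace carrier]
  [charted : ChartedSpace (EuclideanSpace ℝ (Fin 3)) carrier]
  [smooth : IsManifold (𝓡 3) ∞ carrier]
  [t2 : T2Space carrier]
  [secondCountable : SecondCountableTopology carrier]

namespace ThreeManifold

instance : CoeSort ThreeManifold.{u} (Type u) := ⟨carrier⟩

attribute [instance] top charted smooth t2 secondCountable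

/-- Connected components of a manifold are open. -/
theorem isOpen_connectedComponent (M : ThreeManifold.{u}) (x : M) :
    IsOpen (connectedComponent x) :=
  haveI : LocallyConnectedSpace M :=
    ChartedSpace.locallyConnectedSpace (EuclideanSpace ℝ (Fin 3)) M
  _root_.isOpen_connectedComponent

/-- The connected component of `x` in `M`, as a manifold in its own right. -/
def component (M : ThreeManifold.{u}) (x : M) : ThreeManifold.{u} where
  carrier := (⟨connectedComponent x, M.isOpen_connectedComponent x⟩ : TopologicalSpace.Opens M)

/-- A closed manifold is a compact one (the boundary is empty anyway). -/
def IsClosedManifold (M : ThreeManifold.{u}) : Prop := CompactSpace M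

/-- The unit sphere `S² ⊆ ℝ³`. -/
abbrev S2 : Type := sphere (0 : EuclideanSpace ℝ (Fin 3)) 1

/-- Diffeomorphisms from an open subset (`source`) of `M` onto an open subset (`target`) of `N`. -/
abbrev OpenDiffeo (M N : ThreeManifold.{u}) :=
  PartialDiffeomorph (𝓡 3) (𝓡 3) M N ∞

/-- Diffeomorphisms from an open subset of `S² × ℝ` onto an open subset of `M`. -/
abbrev TubeMap (M : ThreeManifold.{u}) :=
  PartialDiffeomorph ((𝓡 2).prod 𝓘(ℝ, ℝ)) (𝓡 3) (S2 × ℝ) M ∞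

/-- Diffeomorphisms from an open subset of `ℝ³` onto an open subset of `M`. -/
abbrev BallMap (M : ThreeManifold.{u}) :=
  PartialDiffeomorph (𝓡 3) (𝓡 3) (EuclideanSpace ℝ (Fin 3)) M ∞

/-- `τ : S² × (-δ, δ) → M` parametrizes an open tubular neighbourhood of the smoothly embedded
`2`-sphere `S = τ (S² × {0})`. -/
def IsTube {M : ThreeManifold.{u}} (τ : TubeMap M) (δ : ℝ) (S : Set M) : Prop :=
  0 < δ ∧ τ.source = univ ×ˢ Ioo (-δ) δ ∧ τ '' (univ ×ˢ {0}) = S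

/-- The set `B` is a closed `3`-ball in `M'` which caps off the side `s = ±1` of the sphere
`τ (S² × {0})` of `M`; here `e` is the inclusion into `M'` of the complement in `M` of the cutting
spheres. Namely `B` is the image of the closed unit ball under a diffeomorphism `φ` from the ball
of radius `1 + δ` onto an open ball of `M'`, the rest of this open ball is the half
`τ (S² × s(0, δ))` of the tubular neighbourhood, and `∂B` is attached to the sphere by a
diffeomorphism `h`. -/
def IsCap {M M' : ThreeManifold.{u}} (e : OpenDiffeo M M') (τ : TubeMap M) (δ s : ℝ)
    (B : Set M') : Prop :=
  ∃ (φ : BallMap M') (h : S2 ≃ₘ^∞⟮𝓡 2, 𝓡 2⟯ S2),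
    φ.source = ball 0 (1 + δ) ∧
    φ '' closedBall 0 1 = B ∧
    ∀ (u : S2) (t : ℝ), 0 < t → t < δ →
      φ ((1 + t) • (u : EuclideanSpace ℝ (Fin 3))) = e (τ (h u, s * t))

/-- `M'` is obtained from `M` by splitting along the collection `𝒮` of pairwise disjoint embedded
`2`-spheres, which is locally finite, and capping off `3`-balls:
`M'` is the disjoint union of (a copy under `e` of) `M ∖ ⋃ 𝒮` and of a collection `ℬ` of closed
`3`-balls; each `S ∈ 𝒮` has a tubular neighbourhood, containing no point of the other spheres,
both sides of which are capped off by balls of `ℬ`; and each ball of `ℬ` arises in this way. -/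
def IsCappingOff (M M' : ThreeManifold.{u}) (𝒮 : Set (Set M)) : Prop :=
  𝒮.PairwiseDisjoint id ∧
  LocallyFinite (fun S : 𝒮 => (S : Set M)) ∧
  ∃ (ℬ : Set (Set M')) (e : OpenDiffeo M M'),
    ℬ.PairwiseDisjoint id ∧
    e.source = (⋃₀ 𝒮)ᶜ ∧
    e.target = (⋃₀ ℬ)ᶜ ∧
    ∃ (τ : 𝒮 → TubeMap M) (δ : 𝒮 → ℝ) (capPos capNeg : 𝒮 → Set M'),
      (∀ S : 𝒮, IsTube (τ S) (δ S) (S : Set M) ∧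
        (τ S).target ∩ ⋃₀ 𝒮 = S ∧
        IsCap e (τ S) (δ S) 1 (capPos S) ∧
        IsCap e (τ S) (δ S) (-1) (capNeg S)) ∧
      ℬ = range capPos ∪ range capNeg

/-- A diffeomorphism of `M` onto an open subset of `N`. -/
def IsOpenEmb {M N : ThreeManifold.{u}} (f : M → N) : Prop :=
  Function.Injective f ∧ IsLocalDiffeomorph (𝓡 3) (𝓡 3) ∞ f

/-- `N` is a disjoint union of manifolds `Y i`, each of which is (a copy of) a member of `𝒳`. -/
def IsDisjointUnionOf (𝒳 : Set ThreeManifold.{u}) (N : ThreeManifold.{u}) : Prop :=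
  ∃ (ι : Type u) (Y : ι → ThreeManifold.{u}) (j : ∀ i, Y i → N),
    (∀ i, Y i ∈ 𝒳) ∧
    (∀ i, IsOpenEmb (j i)) ∧
    Pairwise (fun i k => Disjoint (range (j i)) (range (j k))) ∧
    ⋃ i, range (j i) = univ

/-- `M` is a possibly infinite connected sum of members of `𝒳`: for some locally finite collection
of pairwise disjoint embedded `2`-spheres in `M`, splitting `M` along it and capping off `3`-balls
yields a disjoint union of copies of members of `𝒳`. Equivalently, `M` arises by gluing punctured
copies of members of `𝒳` along the edges of a graph: its vertices are the summands, its edges are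
the spheres, and the edge `S` joins the two summands containing the two balls that cap off `S`. -/
def IsConnectedSum (𝒳 : Set ThreeManifold.{u}) (M : ThreeManifold.{u}) : Prop :=
  ∃ (N : ThreeManifold.{u}) (𝒮 : Set (Set M)), IsCappingOff M N 𝒮 ∧ IsDisjointUnionOf 𝒳 N

/-- `N` is obtained from `M` by splitting along a locally finite collection of pairwise disjoint
embedded `2`-spheres, capping off `3`-balls, and removing some components which are connected
sums of members of `𝒳`. The result of the first two operations is `M'`, and `k` identifies `N`
with the union of the components of `M'` that are kept. -/
def IsSurgeryStep (𝒳 : Set ThreeManifold.{u}) (M N : ThreeManifold.{u}) : Prop :=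
  ∃ (M' : ThreeManifold.{u}) (𝒮 : Set (Set M)) (k : N → M'),
    IsCappingOff M M' 𝒮 ∧
    IsOpenEmb k ∧
    (∀ x ∈ range k, connectedComponent x ⊆ range k) ∧
    ∀ x ∉ range k, IsConnectedSum 𝒳 (M'.component x)

end ThreeManifold

end

/-! The proof goes backwards along the sequence: if every component of $M_i$ is a connected sum, so
is every component of $M_{i-1}$. The last manifold is empty, so the induction starts vacuously.

For one step, let $M'$ be the result of splitting $M$ and capping off, before components are
removed. Every component of $M'$ is a connected sum, by induction if it is kept and by hypothesis if
it is removed. A component $C$ of $M$ splits into a union $B$ of components of $M'$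
(`Capping.exists_component`). Taking the disjoint union of the splittings of its components makes
$B$ a connected sum, even if $B$ is disconnected (`isConnectedSum_of_component`).

It remains to combine the splitting of $C$ into $B$ with the splitting of $B$ into members of
$\mathcal X$ (`Capping.isConnectedSum`). If the spheres in $B$ avoid the balls that cap off $C$,
they lift to $C$, and both families together split $C$ in one go (`Capping.comp`,
`Capping.exists_comp`). In general the spheres may meet the balls, or even lie inside them. But
their union is closed with empty interior, so each ball contains a small ball that misses it. A
diffeomorphism supported near the balls shrinks each of them into such a small ball; composing the
identification of the capped manifold with it removes all intersections
(`Capping.exists_ball_disjoint`). Infinitely many balls can be moved at once because the caps, once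
the tubes are thin, are pairwise disjoint and locally finite. -/

noncomputable section

/-! ### Partial diffeomorphisms. -/

namespace PartialDiffeomorph

variable {E F G : Type*} [NormedAddCommGroup E] [NormedSpace ℝ E]
  [NormedAddCommGroup F] [NormedSpace ℝ F] [NormedAddCommGroup G] [NormedSpace ℝ G]
  {H₁ H₂ H₃ : Type*} [TopologicalSpace H₁] [TopologicalSpace H₂] [TopologicalSpace H₃]
  {I : ModelWithCorners ℝ E H₁} {J : ModelWithCorners ℝ F H₂} {K : ModelWithCorners ℝ G H₃}
  {X Y Z : Type*} [TopologicalSpace X] [ChartedSpace H₁ X]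
  [TopologicalSpace Y] [ChartedSpace H₂ Y] [TopologicalSpace Z] [ChartedSpace H₃ Z]
  {n : WithTop ℕ∞}

/-- The restriction of a partial diffeomorphism to an open set. -/
def restrOpen (Φ : PartialDiffeomorph I J X Y n) (U : Set X) (hU : IsOpen U) :
    PartialDiffeomorph I J X Y n where
  __ := Φ.toOpenPartialHomeomorph.restrOpen U hU
  contMDiffOn_toFun := Φ.contMDiffOn_toFun.mono inter_subset_left
  contMDiffOn_invFun := Φ.contMDiffOn_invFun.mono inter_subset_left

@[simp] theorem restrOpen_source (Φ : PartialDiffeomorph I J X Y n) (U : Set X) (hU : IsOpen U) :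
    (Φ.restrOpen U hU).source = Φ.source ∩ U := rfl

@[simp] theorem trans_apply (Φ : PartialDiffeomorph I J X Y n) (Ψ : PartialDiffeomorph J K Y Z n)
    (x : X) : Φ.trans Ψ x = Ψ (Φ x) := rfl

@[simp] theorem trans_source' (Φ : PartialDiffeomorph I J X Y n)
    (Ψ : PartialDiffeomorph J K Y Z n) :
    (Φ.trans Ψ).source = Φ.source ∩ Φ ⁻¹' Ψ.source := rfl

@[simp] theorem symm_source' (Φ : PartialDiffeomorph I J X Y n) :
    Φ.symm.source = Φ.target := rfl

@[simp] theorem symm_target' (Φ : PartialDiffeomorph I J X Y n) :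
    Φ.symm.target = Φ.source := rfl

@[simp] theorem symm_apply_apply (Φ : PartialDiffeomorph I J X Y n) {x : X} (hx : x ∈ Φ.source) :
    Φ.symm (Φ x) = x := Φ.left_inv hx

@[simp] theorem apply_symm_apply (Φ : PartialDiffeomorph I J X Y n) {y : Y} (hy : y ∈ Φ.target) :
    Φ (Φ.symm y) = y := Φ.right_inv hy

theorem apply_mem (Φ : PartialDiffeomorph I J X Y n) {x : X} (hx : x ∈ Φ.source) :
    Φ x ∈ Φ.target := Φ.map_source hx

theorem symm_apply_mem (Φ : PartialDiffeomorph I J X Y n) {y : Y} (hy : y ∈ Φ.target) :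
    Φ.symm y ∈ Φ.source := Φ.map_target hy

theorem image_source (Φ : PartialDiffeomorph I J X Y n) : Φ '' Φ.source = Φ.target :=
  Φ.toPartialEquiv.image_source_eq_target

theorem injOn' (Φ : PartialDiffeomorph I J X Y n) : InjOn Φ Φ.source := Φ.toPartialEquiv.injOn

theorem continuousOn' (Φ : PartialDiffeomorph I J X Y n) : ContinuousOn Φ Φ.source :=
  Φ.contMDiffOn_toFun.continuousOn

theorem target_eq_image (Φ : PartialDiffeomorph I J X Y n) : Φ.target = Φ '' Φ.source :=
  Φ.image_source.symm

theorem isOpen_image (Φ : PartialDiffeomorph I J X Y n) {U : Set X} (hU : IsOpen U)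
    (hs : U ⊆ Φ.source) : IsOpen (Φ '' U) :=
  Φ.toOpenPartialHomeomorph.isOpen_image_of_subset_source hU hs

theorem isOpen_preimage (Φ : PartialDiffeomorph I J X Y n) {U : Set Y} (hU : IsOpen U) :
    IsOpen (Φ.source ∩ Φ ⁻¹' U) :=
  Φ.toOpenPartialHomeomorph.isOpen_inter_preimage hU

@[simp] theorem trans_target' (Φ : PartialDiffeomorph I J X Y n)
    (Ψ : PartialDiffeomorph J K Y Z n) :
    (Φ.trans Ψ).target = Ψ.target ∩ Ψ.symm ⁻¹' Φ.target :=
  PartialEquiv.trans_target Φ.toPartialEquiv Ψ.toPartialEquiv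

@[simp] theorem symm_symm' (Φ : PartialDiffeomorph I J X Y n) (x : X) :
    Φ.symm.symm x = Φ x := rfl

theorem restrOpen_target (Φ : PartialDiffeomorph I J X Y n) (U : Set X) (hU : IsOpen U) :
    (Φ.restrOpen U hU).target = Φ '' (Φ.source ∩ U) :=
  target_eq_image _

/-- A chart, as a partial diffeomorphism onto an open subset of the model space. -/
def ofChart [IsManifold I n X] (c : OpenPartialHomeomorph X H₁)
    (hc : c ∈ IsManifold.maximalAtlas I n X) : PartialDiffeomorph I I X H₁ n where
  __ := c
  contMDiffOn_toFun := contMDiffOn_of_mem_maximalAtlas hc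
  contMDiffOn_invFun := contMDiffOn_symm_of_mem_maximalAtlas hc

/-- An injective local diffeomorphism, as a partial diffeomorphism with source `univ`. -/
theorem exists_of_isLocalDiffeomorph [Nonempty X] {f : X → Y} (hf : IsLocalDiffeomorph I J n f)
    (hinj : Function.Injective f) :
    ∃ Φ : PartialDiffeomorph I J X Y n, (Φ : X → Y) = f ∧ Φ.source = univ ∧
      Φ.target = range f := by
  refine ⟨{ toFun := f
            -- `Nonempty X` only provides values off the range of `f`; this is why nonemptiness is
            -- assumed or checked in several places below.
            invFun := Function.invFun f
            source := univ
            target := range f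
            map_source' := fun x _ => mem_range_self x
            map_target' := fun _ _ => mem_univ _
            left_inv' := fun x _ => Function.leftInverse_invFun hinj x
            right_inv' := fun y hy => Function.invFun_eq hy
            open_source := isOpen_univ
            open_target := hf.isOpen_range
            contMDiffOn_toFun := hf.contMDiff.contMDiffOn
            contMDiffOn_invFun := ?_ }, rfl, rfl, rfl⟩
  rintro _ ⟨x, rfl⟩
  obtain ⟨Φ, hx, hΦ⟩ := hf x
  have hy : f x ∈ Φ.target := by rw [hΦ hx]; exact Φ.apply_mem hx
  refine ContMDiffAt.contMDiffWithinAt ?_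
  refine ((Φ.symm.contMDiffOn.congr fun y hy' => ?_).contMDiffAt
    (Φ.open_target.mem_nhds hy))
  apply hinj
  rw [Function.invFun_eq (⟨Φ.symm y, by rw [hΦ (Φ.symm_apply_mem hy'), Φ.apply_symm_apply hy']⟩ :
    ∃ z, f z = y), hΦ (Φ.symm_apply_mem hy'), Φ.apply_symm_apply hy']

end PartialDiffeomorph

/-- In the charts `c` and `d` the map reads as the identity, so near `x` it is `c` followed by the
inverse of `d`. -/
theorem isLocalDiffeomorphAt_of_charts {E H : Type*} [NormedAddCommGroup E] [NormedSpace ℝ E]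
    [TopologicalSpace H] {I : ModelWithCorners ℝ E H} {X Y : Type*} [TopologicalSpace X]
    [ChartedSpace H X] [TopologicalSpace Y] [ChartedSpace H Y] {n : WithTop ℕ∞}
    [IsManifold I n X] [IsManifold I n Y] {f : X → Y} {x : X} {c : OpenPartialHomeomorph X H}
    {d : OpenPartialHomeomorph Y H} (hc : c ∈ IsManifold.maximalAtlas I n X)
    (hd : d ∈ IsManifold.maximalAtlas I n Y) (hx : x ∈ c.source)
    (h : ∀ z ∈ c.source, f z ∈ d.source ∧ d (f z) = c z) : IsLocalDiffeomorphAt I I n f x := by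
  refine ⟨(PartialDiffeomorph.ofChart c hc).trans (PartialDiffeomorph.ofChart d hd).symm,
    ⟨hx, ?_⟩, fun z hz => ?_⟩
  · change c x ∈ d.target
    rw [← (h x hx).2]
    exact d.map_source (h x hx).1
  · change f z = d.symm (c z)
    rw [← (h z hz.1).2, d.left_inv (h z hz.1).1]

/-! ### Open submanifolds and disjoint unions. -/

namespace ThreeManifold

/-- An open subset of a `3`-manifold, as a `3`-manifold. -/
def ofOpens (M : ThreeManifold.{u}) (U : TopologicalSpace.Opens M) : ThreeManifold.{u} where
  carrier := U

theorem isOpenEmb_ofOpens (M : ThreeManifold.{u}) (U : TopologicalSpace.Opens M) :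
    IsOpenEmb (M := M.ofOpens U) (N := M) (fun x : U => (x : M)) := by
  refine ⟨Subtype.val_injective, fun (x : U) => ?_⟩
  have h : ∀ z ∈ (chartAt (EuclideanSpace ℝ (Fin 3)) x).source,
      (z : M) ∈ (chartAt (EuclideanSpace ℝ (Fin 3)) (x : M)).source ∧
      chartAt (EuclideanSpace ℝ (Fin 3)) (x : M) z = chartAt (EuclideanSpace ℝ (Fin 3)) x z := by
    intro z hz
    rw [TopologicalSpace.Opens.chartAt_eq] at hz ⊢
    simp only [OpenPartialHomeomorph.subtypeRestr_source] at hz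
    exact ⟨hz, rfl⟩
  exact isLocalDiffeomorphAt_of_charts (I := 𝓡 3) (n := ∞) (X := M.ofOpens U) (Y := M)
    (IsManifold.chart_mem_maximalAtlas (M := M.ofOpens U) x)
    (IsManifold.chart_mem_maximalAtlas (x : M)) (mem_chart_source _ x) h

/-- The inclusion of a connected component. -/
def componentVal (M : ThreeManifold.{u}) (x : M) : M.component x → M :=
  fun y => Subtype.val (p := fun z => z ∈ connectedComponent x) y

theorem isOpenEmb_componentVal (M : ThreeManifold.{u}) (x : M) : IsOpenEmb (M.componentVal x) :=
  M.isOpenEmb_ofOpens ⟨connectedComponent x, M.isOpen_connectedComponent x⟩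

theorem range_componentVal (M : ThreeManifold.{u}) (x : M) :
    range (M.componentVal x) = connectedComponent x :=
  Subtype.range_val

theorem exists_openDiffeo {M N : ThreeManifold.{u}} [Nonempty M] {f : M → N} (hf : IsOpenEmb f) :
    ∃ Φ : OpenDiffeo M N, (Φ : M → N) = f ∧ Φ.source = univ ∧ Φ.target = range f :=
  PartialDiffeomorph.exists_of_isLocalDiffeomorph hf.2 hf.1

section Sigma

variable {ι : Type u} (M : ι → ThreeManifold.{u})

instance sigmaChartedSpace : ChartedSpace (EuclideanSpace ℝ (Fin 3)) (Σ i, M i) where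
  atlas := ⋃ i, (fun c => c.lift_openEmbedding
    (Topology.IsOpenEmbedding.sigmaMk (σ := fun i => M i) (i := i))) '' atlas _ (M i)
  chartAt x := (chartAt _ x.2).lift_openEmbedding
    (Topology.IsOpenEmbedding.sigmaMk (σ := fun i => M i) (i := x.1))
  mem_chart_source x := ⟨x.2, mem_chart_source _ x.2, rfl⟩
  chart_mem_atlas x := mem_iUnion.2 ⟨x.1, mem_image_of_mem _ (chart_mem_atlas _ x.2)⟩

instance sigmaIsManifold : IsManifold (𝓡 3) ∞ (Σ i, M i) where
  compatible {e e'} he he' := by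
    obtain ⟨_, ⟨i, rfl⟩, f, hf, rfl⟩ := he
    obtain ⟨_, ⟨k, rfl⟩, f', hf', rfl⟩ := he'
    by_cases hik : i = k
    · subst hik
      simp only [OpenPartialHomeomorph.lift_openEmbedding_trans]
      exact (contDiffGroupoid ∞ (𝓡 3)).compatible hf hf'
    -- Charts of distinct summands have disjoint domains, so their transition map is empty.
    · apply ContDiffGroupoid.mem_of_source_eq_empty
      ext x
      refine ⟨fun ⟨hx₁, hx₂⟩ => ?_, fun hx => hx.elim⟩
      simp at hx₁ hx₂
      grind

/-- The disjoint union of countably many `3`-manifolds. -/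
def sigma [Countable ι] : ThreeManifold.{u} where
  carrier := Σ i, M i

theorem isOpenEmb_sigmaMk [Countable ι] (i : ι) :
    IsOpenEmb (M := M i) (N := sigma M) (fun x => (⟨i, x⟩ : Σ i, M i)) := by
  refine ⟨sigma_mk_injective (β := fun i => M i), fun x => ?_⟩
  exact isLocalDiffeomorphAt_of_charts (I := 𝓡 3) (n := ∞) (X := M i) (Y := sigma M)
    (IsManifold.chart_mem_maximalAtlas x)
    (IsManifold.chart_mem_maximalAtlas (M := sigma M) (⟨i, x⟩ : Σ i, M i)) (mem_chart_source _ x)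
    fun z hz => ⟨⟨z, hz, rfl⟩, OpenPartialHomeomorph.lift_openEmbedding_apply _ _⟩

end Sigma

/-! ### Splittings as indexed data. -/

variable {A B M M' N P : ThreeManifold.{u}}

/-- The core sphere of a tube. -/
def sphereOf (τ : TubeMap M) : Set M := τ '' (univ ×ˢ {0})

/-- The closed ball parametrized by a ball map. -/
def ballOf (φ : BallMap M) : Set M := φ '' closedBall 0 1

/-- The sign of a side of a sphere. -/
def side (b : Bool) : ℝ := cond b 1 (-1)

theorem abs_side (b : Bool) : |side b| = 1 := by cases b <;> simp [side]

theorem abs_side_mul (b : Bool) (t : ℝ) : |side b * t| = |t| := by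
  rw [abs_mul, abs_side, one_mul]

theorem exists_side_mul {t : ℝ} (ht : t ≠ 0) : ∃ b, t = side b * |t| := by
  rcases lt_or_gt_of_ne ht with h | h
  · exact ⟨false, by simp [side, abs_of_neg h]⟩
  · exact ⟨true, by simp [side, abs_of_pos h]⟩

theorem exists_polar {δ : ℝ} {z : EuclideanSpace ℝ (Fin 3)} (hz : z ∈ ball 0 (1 + δ))
    (hz' : z ∉ closedBall 0 1) :
    ∃ (v : S2) (t : ℝ), 0 < t ∧ t < δ ∧ z = (1 + t) • (v : EuclideanSpace ℝ (Fin 3)) := by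
  rw [mem_ball_zero_iff] at hz
  rw [mem_closedBall_zero_iff, not_le] at hz'
  have h0 : ‖z‖ ≠ 0 := by positivity
  refine ⟨⟨‖z‖⁻¹ • z, ?_⟩, ‖z‖ - 1, by linarith, by linarith, ?_⟩
  · simp [norm_smul, h0]
  · simp [smul_smul, h0]

theorem polar_mem_ball {δ t : ℝ} (h0 : 0 < t) (ht : t < δ) (v : S2) :
    (1 + t) • (v : EuclideanSpace ℝ (Fin 3)) ∈ ball 0 (1 + δ) := by
  rw [mem_ball_zero_iff, norm_smul, norm_eq_of_mem_sphere, mul_one, Real.norm_eq_abs,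
    abs_of_pos (by linarith)]
  linarith

/-- All the data witnessing that `M'` is obtained from `M` by splitting along a family of spheres
indexed by `ι` and capping off balls. -/
structure Capping (M M' : ThreeManifold.{u}) (ι : Type u) where
  e : OpenDiffeo M M'
  τ : ι → TubeMap M
  δ : ι → ℝ
  φ : ι → Bool → BallMap M'
  h : ι → Bool → (S2 ≃ₘ^∞⟮𝓡 2, 𝓡 2⟯ S2)
  δ_pos : ∀ i, 0 < δ i
  τ_source : ∀ i, (τ i).source = univ ×ˢ Ioo (-δ i) (δ i)
  φ_source : ∀ i b, (φ i b).source = ball 0 (1 + δ i)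
  collar : ∀ i b (v : S2) (t : ℝ), 0 < t → t < δ i →
    φ i b ((1 + t) • (v : EuclideanSpace ℝ (Fin 3))) = e (τ i (h i b v, side b * t))
  locallyFinite : LocallyFinite fun i => sphereOf (τ i)
  e_source : e.source = (⋃ i, sphereOf (τ i))ᶜ
  e_target : e.target = (⋃ a : ι × Bool, ballOf (φ a.1 a.2))ᶜ
  tube_disjoint : ∀ i k, i ≠ k → Disjoint (τ i).target (sphereOf (τ k))
  -- The balls come from a set, so different sides of spheres could a priori share one;
  -- `ball_disjoint` excludes this when the tubes are disjoint.
  ball_eq_or_disjoint : ∀ a b : ι × Bool, ballOf (φ a.1 a.2) = ballOf (φ b.1 b.2) ∨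
    Disjoint (ballOf (φ a.1 a.2)) (ballOf (φ b.1 b.2))

namespace Capping

variable {ι κ : Type u} (c : Capping M M' ι)

theorem mem_source {i : ι} {v : S2} {t : ℝ} : (v, t) ∈ (c.τ i).source ↔ |t| < c.δ i := by
  rw [c.τ_source, mem_prod, mem_Ioo, abs_lt]; simp

theorem sphere_subset (i : ι) : sphereOf (c.τ i) ⊆ (c.τ i).target := by
  rintro _ ⟨⟨v, t⟩, ⟨-, ht⟩, rfl⟩
  obtain rfl : t = 0 := ht
  exact (c.τ i).apply_mem (c.mem_source.2 (by simpa using c.δ_pos i))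

theorem ball_subset (i : ι) (b : Bool) : ballOf (c.φ i b) ⊆ (c.φ i b).target := by
  rintro _ ⟨z, hz, rfl⟩
  refine (c.φ i b).apply_mem ?_
  rw [c.φ_source]
  exact closedBall_subset_ball (by linarith [c.δ_pos i]) hz

theorem mem_tube_iff {i : ι} {x : M} :
    x ∈ (c.τ i).target ↔ ∃ (v : S2) (t : ℝ), |t| < c.δ i ∧ c.τ i (v, t) = x := by
  rw [PartialDiffeomorph.target_eq_image]
  constructor
  · rintro ⟨⟨v, t⟩, h, rfl⟩
    exact ⟨v, t, c.mem_source.1 h, rfl⟩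
  · rintro ⟨v, t, h, rfl⟩
    exact ⟨(v, t), c.mem_source.2 h, rfl⟩

theorem tube_mem_sphere_iff {i : ι} {v : S2} {t : ℝ} (ht : |t| < c.δ i) :
    c.τ i (v, t) ∈ sphereOf (c.τ i) ↔ t = 0 := by
  constructor
  · rintro ⟨⟨w, s⟩, ⟨-, hs⟩, hw⟩
    obtain rfl : s = 0 := hs
    have := (c.τ i).injOn' (c.mem_source.2 (by simpa using c.δ_pos i)) (c.mem_source.2 ht) hw
    exact (Prod.ext_iff.1 this).2.symm
  · rintro rfl
    exact ⟨(v, 0), ⟨mem_univ _, rfl⟩, rfl⟩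

theorem tube_mem_e_source {i : ι} {v : S2} {t : ℝ} (ht : |t| < c.δ i) (h0 : t ≠ 0) :
    c.τ i (v, t) ∈ c.e.source := by
  rw [c.e_source, mem_compl_iff, mem_iUnion]
  rintro ⟨k, hk⟩
  by_cases hik : i = k
  · subst hik
    exact h0 ((c.tube_mem_sphere_iff ht).1 hk)
  · exact (c.tube_disjoint i k hik).le_bot ⟨c.mem_tube_iff.2 ⟨v, t, ht, rfl⟩, hk⟩

theorem e_tube_mem {i : ι} {v : S2} {b : Bool} {t : ℝ} (h0 : 0 < t) (ht : t < c.δ i) :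
    c.e (c.τ i (v, side b * t)) ∈ (c.φ i b).target := by
  obtain ⟨w, rfl⟩ : ∃ w, c.h i b w = v := (c.h i b).surjective v
  rw [← c.collar i b w t h0 ht]
  exact (c.φ i b).apply_mem (by rw [c.φ_source]; exact polar_mem_ball h0 ht w)

/-- Polar coordinates divide the open ball of radius `1 + δ` into the closed unit ball and the
collar, and `collar` identifies the latter with a half tube. -/
theorem mem_cap_iff {i : ι} {b : Bool} {y : M'} :
    y ∈ (c.φ i b).target ↔ y ∈ ballOf (c.φ i b) ∨
      ∃ (v : S2) (t : ℝ), 0 < t ∧ t < c.δ i ∧ c.e (c.τ i (v, side b * t)) = y := by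
  constructor
  · intro hy
    rw [PartialDiffeomorph.target_eq_image] at hy
    obtain ⟨z, hz, rfl⟩ := hy
    rw [c.φ_source] at hz
    by_cases hz' : z ∈ closedBall (0 : EuclideanSpace ℝ (Fin 3)) 1
    · exact Or.inl ⟨z, hz', rfl⟩
    · obtain ⟨v, t, h0, ht, rfl⟩ := exists_polar hz hz'
      exact Or.inr ⟨c.h i b v, t, h0, ht, (c.collar i b v t h0 ht).symm⟩
  · rintro (hy | ⟨v, t, h0, ht, rfl⟩)
    · exact c.ball_subset i b hy
    · exact c.e_tube_mem h0 ht

theorem isCompact_sphere (i : ι) : IsCompact (sphereOf (c.τ i)) := by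
  refine (isCompact_univ.prod isCompact_singleton).image_of_continuousOn
    ((c.τ i).continuousOn'.mono ?_)
  rintro ⟨v, t⟩ ⟨-, ht⟩
  obtain rfl : t = 0 := ht
  exact c.mem_source.2 (by simpa using c.δ_pos i)

theorem isClosed_iUnion_sphere : IsClosed (⋃ i, sphereOf (c.τ i)) := by
  rw [← isOpen_compl_iff, ← c.e_source]
  exact c.e.open_source

/-- Every sphere has tubes contained in a given neighbourhood. -/
theorem exists_tube_subset (i : ι) {W : Set M} (hW : IsOpen W) (h : sphereOf (c.τ i) ⊆ W) :
    ∃ ε > 0, ∀ (v : S2) (t : ℝ), |t| < ε → c.τ i (v, t) ∈ W := by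
  have hK : (univ ×ˢ {0} : Set (S2 × ℝ)) ⊆ (c.τ i).source ∩ c.τ i ⁻¹' W := by
    rintro ⟨v, t⟩ ⟨-, ht⟩
    obtain rfl : t = 0 := ht
    exact ⟨c.mem_source.2 (by simpa using c.δ_pos i), h ⟨(v, 0), ⟨mem_univ _, rfl⟩, rfl⟩⟩
  -- Compactness of `S²` makes the width `ε` uniform along the sphere.
  obtain ⟨ε, hε, h'⟩ := (isCompact_univ.prod isCompact_singleton).exists_thickening_subset_open
    ((c.τ i).isOpen_preimage hW) hK
  refine ⟨ε, hε, fun v t ht => (h' (mem_thickening_iff.2 ⟨(v, 0), ⟨mem_univ _, rfl⟩, ?_⟩)).2⟩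
  simpa [Prod.dist_eq] using ht

/-- Every cap has neighbourhoods contained in a given neighbourhood. -/
theorem exists_cap_subset (i : ι) (b : Bool) {W : Set M'} (hW : IsOpen W)
    (h : ballOf (c.φ i b) ⊆ W) :
    ∃ ε > 0, ∀ z ∈ ball (0 : EuclideanSpace ℝ (Fin 3)) (1 + ε), c.φ i b z ∈ W := by
  have hK : closedBall 0 1 ⊆ (c.φ i b).source ∩ c.φ i b ⁻¹' W := by
    intro z hz
    refine ⟨?_, h ⟨z, hz, rfl⟩⟩
    rw [c.φ_source]
    exact closedBall_subset_ball (by linarith [c.δ_pos i]) hz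
  obtain ⟨ε, hε, h'⟩ := (isCompact_closedBall _ _).exists_thickening_subset_open
    ((c.φ i b).isOpen_preimage hW) hK
  rw [thickening_closedBall hε zero_le_one, add_comm] at h'
  exact ⟨ε, hε, fun z hz => (h' hz).2⟩

/-- Make the tubes thinner. -/
def shrink (ε : ι → ℝ) (hε : ∀ i, 0 < ε i) (hle : ∀ i, ε i ≤ c.δ i) : Capping M M' ι where
  e := c.e
  τ i := (c.τ i).restrOpen (univ ×ˢ Ioo (-ε i) (ε i)) (isOpen_univ.prod isOpen_Ioo)
  δ := ε
  φ i b := (c.φ i b).restrOpen (ball 0 (1 + ε i)) isOpen_ball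
  h := c.h
  δ_pos := hε
  τ_source i := by
    rw [PartialDiffeomorph.restrOpen_source, c.τ_source]
    exact inter_eq_right.2 (prod_mono_right (Ioo_subset_Ioo (by linarith [hle i]) (hle i)))
  φ_source i b := by
    rw [PartialDiffeomorph.restrOpen_source, c.φ_source]
    exact inter_eq_right.2 (ball_subset_ball (by linarith [hle i]))
  collar i b v t h0 ht := c.collar i b v t h0 (ht.trans_le (hle i))
  locallyFinite := c.locallyFinite
  e_source := c.e_source
  e_target := c.e_target
  tube_disjoint i k hik := by
    refine (c.tube_disjoint i k hik).mono_left ?_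
    rw [PartialDiffeomorph.restrOpen_target, PartialDiffeomorph.target_eq_image]
    exact image_mono inter_subset_left
  ball_eq_or_disjoint := c.ball_eq_or_disjoint

end Capping

theorem exists_capping_of_isCappingOff {𝒮 : Set (Set M)} (h : IsCappingOff M M' 𝒮) :
    Nonempty (Capping M M' 𝒮) := by
  obtain ⟨hd, hlf, ℬ, e, hB, hes, het, τ, δ, cp, cn, hcap, rfl⟩ := h
  choose htube hinter hp hn using hcap
  have hcap : ∀ (S : 𝒮) (b : Bool), IsCap e (τ S) (δ S) (side b) (cond b (cp S) (cn S)) := by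
    rintro S (_ | _)
    · exact hn S
    · exact hp S
  choose φ g hφ hball hcol using hcap
  have hS : ∀ S : 𝒮, sphereOf (τ S) = (S : Set M) := fun S => (htube S).2.2
  have hmem : ∀ a : 𝒮 × Bool, ballOf (φ a.1 a.2) ∈ range cp ∪ range cn := by
    rintro ⟨S, _ | _⟩
    · exact Or.inr ⟨S, (hball S false).symm⟩
    · exact Or.inl ⟨S, (hball S true).symm⟩
  have hU : ⋃ a : 𝒮 × Bool, ballOf (φ a.1 a.2) = ⋃₀ (range cp ∪ range cn) := by
    apply subset_antisymm
    · exact iUnion_subset fun a => subset_sUnion_of_mem (hmem a)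
    · rintro y ⟨_, ⟨S, rfl⟩ | ⟨S, rfl⟩, hy⟩
      · exact mem_iUnion.2 ⟨(S, true), by rw [ballOf, hball]; exact hy⟩
      · exact mem_iUnion.2 ⟨(S, false), by rw [ballOf, hball]; exact hy⟩
  refine ⟨{ e := e, τ := τ, δ := δ, φ := φ, h := g,
            δ_pos := fun S => (htube S).1
            τ_source := fun S => (htube S).2.1
            φ_source := hφ
            collar := hcol
            locallyFinite := by simpa only [hS] using hlf
            e_source := by simp only [hS, hes, sUnion_eq_iUnion]
            e_target := by rw [het, hU]
            tube_disjoint := fun S T hST => ?_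
            ball_eq_or_disjoint := fun a b => ?_ }⟩
  · rw [hS, disjoint_left]
    intro x hx hxT
    have h1 : x ∈ (S : Set M) := by
      rw [← hinter S]
      exact ⟨hx, T, T.2, hxT⟩
    exact (hd S.2 T.2 (fun h => hST (Subtype.ext h))).le_bot ⟨h1, hxT⟩
  · by_cases hab : ballOf (φ a.1 a.2) = ballOf (φ b.1 b.2)
    · exact Or.inl hab
    · exact Or.inr (hB (hmem a) (hmem b) hab)

theorem Capping.isCappingOff {ι : Type u} (c : Capping M M' ι) :
    IsCappingOff M M' (range fun i => sphereOf (c.τ i)) := by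
  have hdis : ∀ i k, i ≠ k → Disjoint (sphereOf (c.τ i)) (sphereOf (c.τ k)) := fun i k h =>
    (c.tube_disjoint i k h).mono_left (c.sphere_subset i)
  -- `f` chooses an index for each sphere. It is inverse to the parametrization, because the spheres
  -- are disjoint and nonempty.
  choose f hf using fun S : range fun i => sphereOf (c.τ i) => S.2
  have hinj : Function.Injective f := fun S T h => Subtype.ext (by rw [← hf S, ← hf T, h])
  have hsurj : ∀ i, f ⟨_, mem_range_self i⟩ = i := by
    intro i
    by_contra hne
    have h1 := hdis _ _ hne
    have h2 : sphereOf (c.τ (f ⟨_, mem_range_self i⟩)) = sphereOf (c.τ i) := hf ⟨_, mem_range_self i⟩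
    rw [h2] at h1
    have hne : (univ : Set S2).Nonempty :=
      ⟨⟨EuclideanSpace.single 0 1, by simp⟩, mem_univ _⟩
    obtain ⟨v, -⟩ := hne
    exact h1.le_bot ⟨⟨(v, 0), ⟨mem_univ _, rfl⟩, rfl⟩, ⟨(v, 0), ⟨mem_univ _, rfl⟩, rfl⟩⟩
  refine ⟨?_, ?_, range (fun S => ballOf (c.φ (f S) true)) ∪
    range (fun S => ballOf (c.φ (f S) false)), c.e, ?_, ?_, ?_, fun S => c.τ (f S),
    fun S => c.δ (f S), fun S => ballOf (c.φ (f S) true), fun S => ballOf (c.φ (f S) false), ?_,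
    rfl⟩
  · rintro _ ⟨i, rfl⟩ _ ⟨k, rfl⟩ h
    exact hdis i k (fun hik => h (by rw [hik]))
  · convert c.locallyFinite.comp_injective hinj using 2 with S
    exact (hf S).symm
  · have : ∀ B ∈ range (fun S => ballOf (c.φ (f S) true)) ∪
        range (fun S => ballOf (c.φ (f S) false)), ∃ a : ι × Bool, ballOf (c.φ a.1 a.2) = B := by
      rintro _ (⟨S, rfl⟩ | ⟨S, rfl⟩)
      · exact ⟨(f S, true), rfl⟩
      · exact ⟨(f S, false), rfl⟩
    intro B hB B' hB' hne
    obtain ⟨a, rfl⟩ := this B hB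
    obtain ⟨b, rfl⟩ := this B' hB'
    exact (c.ball_eq_or_disjoint a b).resolve_left hne
  · rw [c.e_source, sUnion_range]
  · rw [c.e_target]
    congr 1
    ext y
    simp only [mem_iUnion, mem_sUnion, mem_union, mem_range, Prod.exists, Bool.exists_bool]
    constructor
    · rintro ⟨i, h | h⟩
      · exact ⟨_, Or.inr ⟨⟨_, mem_range_self i⟩, rfl⟩, by rwa [hsurj]⟩
      · exact ⟨_, Or.inl ⟨⟨_, mem_range_self i⟩, rfl⟩, by rwa [hsurj]⟩
    · rintro ⟨_, ⟨S, rfl⟩ | ⟨S, rfl⟩, h⟩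
      · exact ⟨f S, Or.inr h⟩
      · exact ⟨f S, Or.inl h⟩
  · intro S
    refine ⟨⟨c.δ_pos _, c.τ_source _, hf S⟩, ?_, ⟨c.φ (f S) true, c.h (f S) true, c.φ_source _ _,
      rfl, c.collar (f S) true⟩, ⟨c.φ (f S) false, c.h (f S) false, c.φ_source _ _,
      rfl, c.collar (f S) false⟩⟩
    rw [← hf S, sUnion_range]
    apply subset_antisymm
    · rintro x ⟨hx, hx'⟩
      obtain ⟨k, hk⟩ := mem_iUnion.1 hx'
      by_cases h : f S = k
      · rw [h]; exact hk
      · exact ((c.tube_disjoint _ _ h).le_bot ⟨hx, hk⟩).elim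
    · exact fun x hx => ⟨c.sphere_subset _ hx, mem_iUnion.2 ⟨_, hx⟩⟩

theorem isConnectedSum_iff {𝒳 : Set ThreeManifold.{u}} :
    IsConnectedSum 𝒳 M ↔ ∃ (N : ThreeManifold.{u}) (ι : Type u),
      Nonempty (Capping M N ι) ∧ IsDisjointUnionOf 𝒳 N := by
  constructor
  · rintro ⟨N, 𝒮, h, hN⟩
    exact ⟨N, 𝒮, exists_capping_of_isCappingOff h, hN⟩
  · rintro ⟨N, ι, ⟨c⟩, hN⟩
    exact ⟨N, _, c.isCappingOff, hN⟩

/-! ### Restricting a splitting to open submanifolds. -/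

namespace Capping

variable {ι κ : Type u}

/-- Restrict a splitting of `M` to an open submanifold `A` and to the corresponding open
submanifold `B` of `M'`. -/
def pullback (c : Capping M M' ι) (i : OpenDiffeo A M) (j : OpenDiffeo B M') (p : ι → Prop)
    (hi : i.source = univ) (hj : j.source = univ)
    (hτ : ∀ k, p k → (c.τ k).target ⊆ i.target)
    (hs : ∀ k, ¬ p k → Disjoint (sphereOf (c.τ k)) i.target)
    (hφ : ∀ k b, p k → (c.φ k b).target ⊆ j.target)
    (hb : ∀ k b, ¬ p k → Disjoint (ballOf (c.φ k b)) j.target)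
    (he : ∀ x ∈ c.e.source, x ∈ i.target ↔ c.e x ∈ j.target) :
    Capping A B {k // p k} := by
  have hmi : ∀ x, x ∈ i.source := fun x => hi ▸ mem_univ x
  have hmj : ∀ x, x ∈ j.source := fun x => hj ▸ mem_univ x
  have hsph : ∀ k : {k // p k}, sphereOf ((c.τ k).trans i.symm) = i ⁻¹' sphereOf (c.τ k) := by
    rintro ⟨k, hk⟩
    ext x
    constructor
    · rintro ⟨z, hz, rfl⟩
      have : c.τ k z ∈ sphereOf (c.τ k) := ⟨z, hz, rfl⟩
      rwa [mem_preimage, PartialDiffeomorph.trans_apply,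
        i.apply_symm_apply (hτ k hk (c.sphere_subset k this))]
    · rintro ⟨z, hz, hx⟩
      refine ⟨z, hz, ?_⟩
      rw [PartialDiffeomorph.trans_apply, hx, i.symm_apply_apply (hmi x)]
  have hbal : ∀ (k : {k // p k}) b, ballOf ((c.φ k b).trans j.symm) =
      j ⁻¹' ballOf (c.φ k b) := by
    rintro ⟨k, hk⟩ b
    ext x
    constructor
    · rintro ⟨z, hz, rfl⟩
      have : c.φ k b z ∈ ballOf (c.φ k b) := ⟨z, hz, rfl⟩
      rwa [mem_preimage, PartialDiffeomorph.trans_apply,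
        j.apply_symm_apply (hφ k b hk (c.ball_subset k b this))]
    · rintro ⟨z, hz, hx⟩
      refine ⟨z, hz, ?_⟩
      rw [PartialDiffeomorph.trans_apply, hx, j.symm_apply_apply (hmj x)]
  exact {
    e := (i.trans c.e).trans j.symm
    τ := fun k => (c.τ k).trans i.symm
    δ := fun k => c.δ k
    φ := fun k b => (c.φ k b).trans j.symm
    h := fun k b => c.h k b
    δ_pos := fun k => c.δ_pos k
    τ_source := fun k => by
      rw [PartialDiffeomorph.trans_source', ← c.τ_source]
      exact inter_eq_left.2 fun z hz => hτ k k.2 ((c.τ k).apply_mem hz)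
    φ_source := fun k b => by
      rw [PartialDiffeomorph.trans_source', ← c.φ_source k b]
      exact inter_eq_left.2 fun z hz => hφ k b k.2 ((c.φ k b).apply_mem hz)
    collar := fun k b v t h0 ht => by
      have h1 : |side b * t| < c.δ k := by rw [abs_side_mul, abs_of_pos h0]; exact ht
      simp only [PartialDiffeomorph.trans_apply, c.collar k b v t h0 ht]
      rw [i.apply_symm_apply (hτ k k.2 ((c.τ k).apply_mem (c.mem_source.2 h1)))]
    locallyFinite := by
      simp only [hsph]
      have h1 : ContinuousOn i univ := hi ▸ i.continuousOn'
      exact (c.locallyFinite.preimage_continuous (continuousOn_univ.1 h1)).comp_injective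
        Subtype.val_injective
    e_source := by
      ext x
      simp only [hsph, mem_compl_iff, mem_iUnion, mem_preimage, PartialDiffeomorph.trans_source',
        PartialDiffeomorph.symm_source', mem_inter_iff, PartialDiffeomorph.trans_apply, hmi,
        true_and]
      constructor
      · rintro ⟨h1, h2⟩ ⟨k, hk⟩
        rw [c.e_source] at h1
        exact h1 (mem_iUnion.2 ⟨_, hk⟩)
      · intro h
        have h1 : i x ∈ c.e.source := by
          rw [c.e_source]
          intro h'
          obtain ⟨k, hk⟩ := mem_iUnion.1 h'
          by_cases hpk : p k
          · exact h ⟨⟨k, hpk⟩, hk⟩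
          · exact (hs k hpk).le_bot ⟨hk, i.apply_mem (hmi x)⟩
        exact ⟨h1, (he _ h1).1 (i.apply_mem (hmi x))⟩
    e_target := by
      ext y
      simp only [hbal, mem_compl_iff, mem_iUnion, mem_preimage, PartialDiffeomorph.trans_target',
        PartialDiffeomorph.symm_target', mem_inter_iff, hmj, PartialDiffeomorph.symm_symm',
        true_and]
      constructor
      · rintro ⟨h1, h2⟩ ⟨k, hk⟩
        rw [c.e_target] at h1
        exact h1 (mem_iUnion.2 ⟨(k.1, k.2), hk⟩)
      · intro h
        have h1 : j y ∈ c.e.target := by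
          rw [c.e_target]
          intro h'
          obtain ⟨k, hk⟩ := mem_iUnion.1 h'
          by_cases hpk : p k.1
          · exact h ⟨(⟨k.1, hpk⟩, k.2), hk⟩
          · exact (hb _ _ hpk).le_bot ⟨hk, j.apply_mem (hmj y)⟩
        refine ⟨h1, (he _ (c.e.symm_apply_mem h1)).2 ?_⟩
        rw [c.e.apply_symm_apply h1]
        exact j.apply_mem (hmj y)
    tube_disjoint := fun k l hkl => by
      rw [hsph, disjoint_left]
      rintro x hx hx'
      simp only [PartialDiffeomorph.trans_target'] at hx
      exact (c.tube_disjoint k l (fun h => hkl (Subtype.ext h))).le_bot ⟨hx.2, hx'⟩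
    ball_eq_or_disjoint := fun a b => by
      simp only [hbal]
      rcases c.ball_eq_or_disjoint (a.1, a.2) (b.1, b.2) with h | h
      · exact Or.inl (congrArg _ h)
      · exact Or.inr (h.preimage _) }

end Capping

theorem isConnectedSum_of_diffeo {𝒳 : Set ThreeManifold.{u}} (i : OpenDiffeo A M)
    (hs : i.source = univ) (ht : i.target = univ) (h : IsConnectedSum 𝒳 M) :
    IsConnectedSum 𝒳 A := by
  obtain ⟨N, ι, ⟨c⟩, hN⟩ := isConnectedSum_iff.1 h
  refine isConnectedSum_iff.2 ⟨N, _, ⟨c.pullback i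
    (Diffeomorph.refl (𝓡 3) N ∞).toPartialDiffeomorph (fun _ => True) hs rfl ?_ ?_ ?_ ?_ ?_⟩, hN⟩
  · simp [ht]
  · simp
  · exact fun k b _ x _ => mem_univ _
  · simp
  · exact fun x _ => iff_of_true (ht ▸ mem_univ x) (mem_univ _)

/-! ### Disjoint unions of splittings. -/

section Sigma

variable {κ : Type u} {X Y : κ → ThreeManifold.{u}}

/-- The inclusion of a summand of a disjoint union. -/
def sigmaIncl [Countable κ] (X : κ → ThreeManifold.{u}) (k : κ) (x : X k) : sigma X :=
  (⟨k, x⟩ : Σ k, X k)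

theorem sigmaIncl_injective [Countable κ] {k : κ} : Function.Injective (sigmaIncl X k) :=
  (isOpenEmb_sigmaMk X k).1

theorem sigma_cases [Countable κ] (x : sigma X) : ∃ k y, sigmaIncl X k y = x :=
  ⟨Sigma.fst (β := fun k => X k) x, Sigma.snd (β := fun k => X k) x, rfl⟩

theorem sigmaIncl_eq_iff [Countable κ] {k l : κ} {x : X k} {y : X l} :
    sigmaIncl X k x = sigmaIncl X l y ↔ ∃ h : k = l, h ▸ x = y := by
  constructor
  · intro h
    obtain rfl : k = l := congrArg (Sigma.fst (β := fun k => X k)) h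
    exact ⟨rfl, sigmaIncl_injective h⟩
  · rintro ⟨rfl, rfl⟩; rfl

theorem isOpenEmb_sigmaIncl [Countable κ] (k : κ) : IsOpenEmb (sigmaIncl X k) :=
  isOpenEmb_sigmaMk X k

theorem disjoint_range_sigmaIncl [Countable κ] {k l : κ} (h : k ≠ l) :
    Disjoint (range (sigmaIncl X k)) (range (sigmaIncl X l)) := by
  rw [disjoint_left]
  rintro _ ⟨x, rfl⟩ ⟨y, hy⟩
  exact h (sigmaIncl_eq_iff.1 hy).1.symm

/-- The inclusion of a nonempty summand, as a partial diffeomorphism. -/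
theorem exists_sigmaIncl [Countable κ] {k : κ} (x : X k) :
    ∃ Φ : OpenDiffeo (X k) (sigma X), (Φ : X k → sigma X) = sigmaIncl X k ∧ Φ.source = univ ∧
      Φ.target = range (sigmaIncl X k) :=
  haveI : Nonempty (X k) := ⟨x⟩
  exists_openDiffeo (isOpenEmb_sigmaIncl k)

/-- The map between disjoint unions given by a family of functions. -/
def sigmaFun [Countable κ] (f : ∀ k, X k → Y k) : sigma X → sigma Y :=
  fun x : Σ k, X k => (⟨x.1, f x.1 x.2⟩ : Σ k, Y k)

@[simp] theorem sigmaFun_sigmaIncl [Countable κ] (f : ∀ k, X k → Y k) (k : κ) (x : X k) :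
    sigmaFun f (sigmaIncl X k x) = sigmaIncl Y k (f k x) := rfl

theorem isOpen_iUnion_sigmaIncl [Countable κ] {U : ∀ k, Set (X k)} (hU : ∀ k, IsOpen (U k)) :
    IsOpen (⋃ k, sigmaIncl X k '' U k) :=
  isOpen_iUnion fun k => (isOpenEmb_sigmaIncl k).2.isOpenMap _ (hU k)

theorem contMDiffOn_sigmaFun [Countable κ] {U : ∀ k, Set (X k)} (hU : ∀ k, IsOpen (U k))
    {f : ∀ k, X k → Y k} (hf : ∀ k, ContMDiffOn (𝓡 3) (𝓡 3) ∞ (f k) (U k)) :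
    ContMDiffOn (𝓡 3) (𝓡 3) ∞ (sigmaFun f) (⋃ k, sigmaIncl X k '' U k) := by
  intro x hx
  obtain ⟨k, y, hy, rfl⟩ := mem_iUnion.1 hx
  obtain ⟨Φ, hΦ, hs, ht⟩ := exists_sigmaIncl y
  have hy' : Φ.symm (sigmaIncl X k y) = y := by
    rw [← hΦ, Φ.symm_apply_apply (hs ▸ mem_univ _)]
  have h1 : ContMDiffAt (𝓡 3) (𝓡 3) ∞ Φ.symm (sigmaIncl X k y) :=
    Φ.symm.contMDiffOn.contMDiffAt (Φ.open_target.mem_nhds (ht ▸ mem_range_self y))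
  have h2 : ContMDiffAt (𝓡 3) (𝓡 3) ∞ (f k) (Φ.symm (sigmaIncl X k y)) := by
    rw [hy']
    exact (hf k).contMDiffAt ((hU k).mem_nhds hy)
  have h3 := ((isOpenEmb_sigmaIncl (X := Y) k).2.contMDiff.contMDiffAt.comp _ h2).comp _ h1
  refine (h3.congr_of_eventuallyEq ?_).contMDiffWithinAt
  filter_upwards [Φ.open_target.mem_nhds (ht ▸ mem_range_self y)] with z hz
  rw [ht] at hz
  obtain ⟨w, rfl⟩ := hz
  have : Φ.symm (sigmaIncl X k w) = w := by
    rw [← hΦ, Φ.symm_apply_apply (hs ▸ mem_univ _)]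
  rw [Function.comp_apply, Function.comp_apply, this, sigmaFun_sigmaIncl]

/-- The disjoint union of a family of partial diffeomorphisms. -/
def sigmaMap [Countable κ] (f : ∀ k, OpenDiffeo (X k) (Y k)) :
    OpenDiffeo (sigma X) (sigma Y) where
  toFun := sigmaFun fun k => f k
  invFun := sigmaFun fun k => (f k).symm
  source := ⋃ k, sigmaIncl X k '' (f k).source
  target := ⋃ k, sigmaIncl Y k '' (f k).target
  map_source' := by
    intro x hx
    obtain ⟨k, y, hy, rfl⟩ := mem_iUnion.1 hx
    exact mem_iUnion.2 ⟨k, _, (f k).apply_mem hy, rfl⟩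
  map_target' := by
    intro x hx
    obtain ⟨k, y, hy, rfl⟩ := mem_iUnion.1 hx
    exact mem_iUnion.2 ⟨k, _, (f k).symm_apply_mem hy, rfl⟩
  left_inv' := by
    intro x hx
    obtain ⟨k, y, hy, rfl⟩ := mem_iUnion.1 hx
    rw [sigmaFun_sigmaIncl, sigmaFun_sigmaIncl, (f k).symm_apply_apply hy]
  right_inv' := by
    intro x hx
    obtain ⟨k, y, hy, rfl⟩ := mem_iUnion.1 hx
    rw [sigmaFun_sigmaIncl, sigmaFun_sigmaIncl, (f k).apply_symm_apply hy]
  open_source := isOpen_iUnion_sigmaIncl fun k => (f k).open_source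
  open_target := isOpen_iUnion_sigmaIncl fun k => (f k).open_target
  contMDiffOn_toFun := contMDiffOn_sigmaFun (fun k => (f k).open_source) fun k => (f k).contMDiffOn
  contMDiffOn_invFun := contMDiffOn_sigmaFun (fun k => (f k).open_target)
    fun k => (f k).symm.contMDiffOn

theorem compl_iUnion_sigmaIncl [Countable κ] {ι : κ → Type*} (S : ∀ k, ι k → Set (X k)) :
    ⋃ k, sigmaIncl X k '' (⋃ i, S k i)ᶜ = (⋃ a : Σ k, ι k, sigmaIncl X a.1 '' S a.1 a.2)ᶜ := by
  ext x
  obtain ⟨k, y, rfl⟩ := sigma_cases x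
  simp only [mem_iUnion, mem_image, mem_compl_iff]
  constructor
  · rintro ⟨l, z, hz, hzy⟩ ⟨⟨m, i⟩, w, hw, hwy⟩
    obtain ⟨rfl, rfl⟩ := sigmaIncl_eq_iff.1 hzy
    obtain ⟨rfl, rfl⟩ := sigmaIncl_eq_iff.1 hwy
    exact hz ⟨i, hw⟩
  · intro h
    exact ⟨k, y, fun ⟨i, hi⟩ => h ⟨⟨k, i⟩, y, hi, rfl⟩, rfl⟩

theorem exists_sigma_capping [Countable κ] {ι : κ → Type u} (c : ∀ k, Capping (X k) (Y k) (ι k))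
    [hX : ∀ k, Nonempty (X k)] : Nonempty (Capping (sigma X) (sigma Y) (Σ k, ι k)) := by
  choose i hi his hit using fun k => exists_openDiffeo (isOpenEmb_sigmaIncl (X := X) k)
  -- The centre of a cap is a point of `Y a.1`, as `exists_openDiffeo` requires.
  have hY : ∀ a : Σ k, ι k, Nonempty (Y a.1) := fun a => ⟨(c a.1).φ a.2 true 0⟩
  choose j hj hjs hjt using fun a : Σ k, ι k => (haveI := hY a;
    exists_openDiffeo (isOpenEmb_sigmaIncl (X := Y) a.1))
  have hsph : ∀ a : Σ k, ι k, sphereOf (((c a.1).τ a.2).trans (i a.1)) =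
      sigmaIncl X a.1 '' sphereOf ((c a.1).τ a.2) := by
    intro a
    rw [← hi, sphereOf, sphereOf, image_image]; rfl
  have hbal : ∀ (a : Σ k, ι k) b, ballOf (((c a.1).φ a.2 b).trans (j a)) =
      sigmaIncl Y a.1 '' ballOf ((c a.1).φ a.2 b) := by
    intro a b
    rw [← hj, ballOf, ballOf, image_image]; rfl
  refine ⟨{
    e := sigmaMap fun k => (c k).e
    τ := fun a => ((c a.1).τ a.2).trans (i a.1)
    δ := fun a => (c a.1).δ a.2
    φ := fun a b => ((c a.1).φ a.2 b).trans (j a)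
    h := fun a b => (c a.1).h a.2 b
    δ_pos := fun a => (c a.1).δ_pos a.2
    τ_source := fun a => by simp [his, (c a.1).τ_source]
    φ_source := fun a b => by simp [hjs, (c a.1).φ_source]
    collar := fun a b v t h0 ht => ?_
    locallyFinite := ?_
    e_source := ?_
    e_target := ?_
    tube_disjoint := fun a b hab => ?_
    ball_eq_or_disjoint := fun a b => ?_ }⟩
  · simp only [PartialDiffeomorph.trans_apply, hi, hj, (c a.1).collar a.2 b v t h0 ht]
    rfl
  · simp only [hsph]
    intro x
    obtain ⟨k, y, rfl⟩ := sigma_cases x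
    obtain ⟨U, hU, hfin⟩ := (c k).locallyFinite y
    refine ⟨sigmaIncl X k '' U, (isOpenEmb_sigmaIncl k).2.isOpenMap.image_mem_nhds hU,
      (hfin.image (Sigma.mk k)).subset ?_⟩
    rintro ⟨l, m⟩ ⟨_, ⟨z, hz, rfl⟩, w, hw, hwz⟩
    obtain ⟨h, h'⟩ := sigmaIncl_eq_iff.1 hwz
    dsimp only at h
    subst h
    obtain rfl : w = z := h'
    exact ⟨m, ⟨w, hz, hw⟩, rfl⟩
  · simp only [hsph]
    have h1 := compl_iUnion_sigmaIncl (X := X) (ι := ι) fun k a => sphereOf ((c k).τ a)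
    simp only [← (c _).e_source] at h1
    exact h1
  · simp only [hbal]
    have h1 := compl_iUnion_sigmaIncl (X := Y) (ι := fun k => ι k × Bool)
      fun k a => ballOf ((c k).φ a.1 a.2)
    simp only [← (c _).e_target] at h1
    refine Eq.trans ?_ (h1.trans ?_)
    · rfl
    · congr 1
      ext x
      simp only [mem_iUnion, Sigma.exists, Prod.exists]
  · rw [hsph, disjoint_left]
    rintro x hx ⟨y, hy, rfl⟩
    rw [PartialDiffeomorph.target_eq_image] at hx
    obtain ⟨z, hz, hzy⟩ := hx
    obtain ⟨k, l⟩ := a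
    obtain ⟨k', l'⟩ := b
    simp only [PartialDiffeomorph.trans_apply, hi] at hzy
    obtain ⟨rfl, h⟩ := sigmaIncl_eq_iff.1 hzy
    refine ((c k).tube_disjoint l l' (fun h => hab (by rw [h]))).le_bot ⟨?_, hy⟩
    rw [← h]
    exact ((c k).τ l).apply_mem hz.1
  · simp only [hbal]
    obtain ⟨⟨k, l⟩, s⟩ := a
    obtain ⟨⟨k', l'⟩, s'⟩ := b
    by_cases hk : k = k'
    · subst hk
      rcases (c k).ball_eq_or_disjoint (l, s) (l', s') with h | h
      · exact Or.inl (congrArg _ h)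
      · exact Or.inr ((disjoint_image_iff sigmaIncl_injective).2 h)
    · exact Or.inr ((disjoint_range_sigmaIncl hk).mono (image_subset_range _ _)
        (image_subset_range _ _))

theorem isDisjointUnionOf_sigma [Countable κ] {𝒳 : Set ThreeManifold.{u}}
    (h : ∀ k, IsDisjointUnionOf 𝒳 (X k)) : IsDisjointUnionOf 𝒳 (sigma X) := by
  choose ι Z j hZ hj hdis hun using h
  refine ⟨Σ k, ι k, fun a => Z a.1 a.2, fun a x => sigmaIncl X a.1 (j a.1 a.2 x), fun a => hZ _ _,
    fun a => ⟨sigmaIncl_injective.comp (hj a.1 a.2).1, fun x =>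
      ((hj a.1 a.2).2 x).comp (𝓡 3) (sigma X) ((isOpenEmb_sigmaIncl a.1).2 _)⟩, ?_, ?_⟩
  · rintro ⟨k, i⟩ ⟨k', i'⟩ hne
    by_cases hk : k = k'
    · subst hk
      have := hdis k (fun h : i = i' => hne (by rw [h]))
      simp only [range_comp' (sigmaIncl X k)]
      exact (disjoint_image_iff sigmaIncl_injective).2 this
    · refine (disjoint_range_sigmaIncl hk).mono ?_ ?_ <;>
      · rintro _ ⟨x, rfl⟩; exact mem_range_self _
  · refine eq_univ_of_forall fun x => ?_
    obtain ⟨k, y, rfl⟩ := sigma_cases x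
    have hy : y ∈ ⋃ i, range (j k i) := hun k ▸ mem_univ y
    obtain ⟨i, z, rfl⟩ := mem_iUnion.1 hy
    exact mem_iUnion.2 ⟨⟨k, i⟩, z, rfl⟩

end Sigma

/-! ### Composing two splittings. -/

namespace Capping

variable {ι κ : Type u}

/-- Splitting `M` and then splitting the result along spheres away from the caps amounts to a
single splitting of `M`. This version requires thin tubes. -/
def comp (c : Capping M P ι) (d : Capping P N κ)
    (hφ : ∀ i b, (c.φ i b).target ⊆ d.e.source) (hτ : ∀ k, (d.τ k).target ⊆ c.e.target) :
    Capping M N (ι ⊕ κ) := by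
  have hsph : ∀ k, sphereOf ((d.τ k).trans c.e.symm) = c.e.source ∩ c.e ⁻¹' sphereOf (d.τ k) := by
    intro k
    ext x
    constructor
    · rintro ⟨z, hz, rfl⟩
      have h1 : d.τ k z ∈ sphereOf (d.τ k) := ⟨z, hz, rfl⟩
      have h2 := hτ k (d.sphere_subset k h1)
      refine ⟨c.e.symm_apply_mem h2, ?_⟩
      rwa [mem_preimage, PartialDiffeomorph.trans_apply, c.e.apply_symm_apply h2]
    · rintro ⟨hx, z, hz, hzx⟩
      refine ⟨z, hz, ?_⟩
      rw [PartialDiffeomorph.trans_apply, hzx, c.e.symm_apply_apply hx]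
  have hbal : ∀ i b, ballOf ((c.φ i b).trans d.e) = d.e '' ballOf (c.φ i b) := fun i b => by
    rw [ballOf, ballOf, image_image]; rfl
  have hbs : ∀ i b, ballOf (c.φ i b) ⊆ d.e.source := fun i b => (c.ball_subset i b).trans (hφ i b)
  have hbt : ∀ i b, ballOf ((c.φ i b).trans d.e) ⊆ d.e.target := by
    intro i b
    rw [hbal, PartialDiffeomorph.target_eq_image]
    exact image_mono (hbs i b)
  have hdb : ∀ (a : κ × Bool) i b, Disjoint (ballOf (d.φ a.1 a.2))
      (ballOf ((c.φ i b).trans d.e)) := by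
    intro a i b
    rw [disjoint_left]
    intro y hy hy'
    have := hbt i b hy'
    rw [d.e_target] at this
    exact this (mem_iUnion.2 ⟨a, hy⟩)
  have hcs : ∀ i, Disjoint (sphereOf (c.τ i)) c.e.source := by
    intro i
    rw [c.e_source, disjoint_compl_right_iff_subset]
    exact subset_iUnion (fun i => sphereOf (c.τ i)) i
  have htube : ∀ i k, Disjoint (c.τ i).target (c.e.source ∩ c.e ⁻¹' sphereOf (d.τ k)) := by
    intro i k
    rw [disjoint_left]
    rintro x hx ⟨hxs, hxk⟩
    obtain ⟨v, t, ht, rfl⟩ := c.mem_tube_iff.1 hx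
    have h0 : t ≠ 0 := by
      rintro rfl
      exact (hcs i).le_bot ⟨(c.tube_mem_sphere_iff ht).2 rfl, hxs⟩
    obtain ⟨b, hb⟩ := exists_side_mul h0
    -- Off its core, a tube of `c` is carried by `c.e` into a cap, which by `hφ` contains no point
    -- of the spheres of `d`.
    have h1 := hφ i b (c.e_tube_mem (v := v) (abs_pos.2 h0) ht)
    rw [← hb, d.e_source] at h1
    exact h1 (mem_iUnion.2 ⟨k, hxk⟩)
  have hS : ⋃ s : ι ⊕ κ, sphereOf (Sum.elim c.τ (fun k => (d.τ k).trans c.e.symm) s) =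
      (⋃ i, sphereOf (c.τ i)) ∪ ⋃ k, c.e.source ∩ c.e ⁻¹' sphereOf (d.τ k) := by
    rw [iUnion_sum]
    simp only [Sum.elim_inl, Sum.elim_inr, hsph]
  exact {
    e := c.e.trans d.e
    τ := Sum.elim c.τ fun k => (d.τ k).trans c.e.symm
    δ := Sum.elim c.δ d.δ
    φ := Sum.elim (fun i b => (c.φ i b).trans d.e) d.φ
    h := Sum.elim c.h d.h
    δ_pos := by rintro (i | k); exacts [c.δ_pos i, d.δ_pos k]
    τ_source := by
      rintro (i | k)
      · exact c.τ_source i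
      · refine Eq.trans ?_ (d.τ_source k)
        exact inter_eq_left.2 fun z hz => hτ k ((d.τ k).apply_mem hz)
    φ_source := by
      rintro (i | k) b
      · refine Eq.trans ?_ (c.φ_source i b)
        exact inter_eq_left.2 fun z hz => hφ i b ((c.φ i b).apply_mem hz)
      · exact d.φ_source k b
    collar := by
      rintro (i | k) b v t h0 ht
      · exact congrArg d.e (c.collar i b v t h0 ht)
      · refine (d.collar k b v t h0 ht).trans (congrArg d.e ?_)
        refine (c.e.apply_symm_apply (hτ k ((d.τ k).apply_mem (d.mem_source.2 ?_)))).symm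
        rw [abs_side_mul, abs_of_pos h0]; exact ht
    locallyFinite := by
      have h1 : LocallyFinite fun k => sphereOf ((d.τ k).trans c.e.symm) := by
        intro x
        simp only [hsph]
        by_cases hx : x ∈ c.e.source
        · obtain ⟨U, hU, hfin⟩ := d.locallyFinite (c.e x)
          refine ⟨c.e ⁻¹' U, (c.e.continuousOn'.continuousAt (c.e.open_source.mem_nhds hx)) hU,
            hfin.subset ?_⟩
          rintro k ⟨y, hy, hyU⟩
          exact ⟨c.e y, hy.2, hyU⟩
        · rw [c.e_source, notMem_compl_iff] at hx
          obtain ⟨i, hi⟩ := mem_iUnion.1 hx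
          -- The lifted spheres could only accumulate on a sphere of `c`, but the tube around that
          -- sphere meets none of them.
          refine ⟨_, (c.τ i).open_target.mem_nhds (c.sphere_subset i hi), ?_⟩
          convert finite_empty
          refine eq_empty_of_forall_notMem fun k ⟨y, hy, hyU⟩ => ?_
          exact (htube i k).le_bot ⟨hyU, hy⟩
      convert c.locallyFinite.sumElim h1 using 2 with s
      cases s <;> rfl
    e_source := by
      rw [hS]
      ext x
      simp only [PartialDiffeomorph.trans_source', mem_inter_iff, mem_preimage, compl_union,
        c.e_source, d.e_source, mem_compl_iff, mem_iUnion, not_exists, not_and]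
      tauto
    e_target := by
      ext y
      simp only [PartialDiffeomorph.trans_target', mem_inter_iff, mem_preimage, mem_compl_iff,
        mem_iUnion, Prod.exists, Sum.exists, Sum.elim_inl, Sum.elim_inr, hbal, not_or]
      have h1 : y ∈ d.e.target ↔ ¬ ∃ k b, y ∈ ballOf (d.φ k b) := by
        rw [d.e_target]; simp
      have h2 : d.e.symm y ∈ c.e.target ↔ ¬ ∃ i b, d.e.symm y ∈ ballOf (c.φ i b) := by
        rw [c.e_target]; simp
      rw [h2, ← h1, and_comm (b := y ∈ d.e.target)]
      refine and_congr_right fun hy => not_congr (exists_congr fun i => exists_congr fun b => ?_)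
      constructor
      · exact fun h => ⟨_, h, d.e.apply_symm_apply hy⟩
      · rintro ⟨z, hz, rfl⟩
        rwa [d.e.symm_apply_apply (hbs i b hz)]
    tube_disjoint := by
      rintro (i | k) (i' | k') hne
      · exact c.tube_disjoint i i' (fun h => hne (congrArg _ h))
      · simp only [Sum.elim_inl, Sum.elim_inr, hsph]
        exact htube i k'
      · simp only [Sum.elim_inl, Sum.elim_inr]
        refine ((hcs i').mono_right ?_).symm
        exact (PartialDiffeomorph.trans_target' _ _).le.trans inter_subset_left
      · simp only [Sum.elim_inr, hsph, disjoint_left]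
        rintro x hx ⟨-, hx'⟩
        exact (d.tube_disjoint k k' (fun h => hne (congrArg _ h))).le_bot
          ⟨((PartialDiffeomorph.trans_target' _ _).le hx).2, hx'⟩
    ball_eq_or_disjoint := by
      rintro ⟨i | k, b⟩ ⟨i' | k', b'⟩
      · simp only [Sum.elim_inl, hbal]
        rcases c.ball_eq_or_disjoint (i, b) (i', b') with h | h
        · exact Or.inl (congrArg _ h)
        · refine Or.inr ?_
          rw [disjoint_left]
          rintro _ ⟨x, hx, rfl⟩ ⟨y, hy, hyx⟩
          obtain rfl := d.e.injOn' (hbs i' b' hy) (hbs i b hx) hyx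
          exact h.le_bot ⟨hx, hy⟩
      · exact Or.inr (hdb (k', b') i b).symm
      · exact Or.inr (hdb (k, b) i' b')
      · exact d.ball_eq_or_disjoint (k, b) (k', b') }

end Capping

end ThreeManifold

/-! ### Compactly supported diffeomorphisms of Euclidean space. -/

section Radial

variable {E : Type*} [NormedAddCommGroup E] [InnerProductSpace ℝ E] [FiniteDimensional ℝ E]

/-- A smooth bijection with invertible derivatives is a diffeomorphism. -/
theorem exists_diffeomorph_of_bijective {f : E → E} (hf : ContDiff ℝ ∞ f)
    (hb : Function.Bijective f) (hd : ∀ x, Function.Injective (fderiv ℝ f x)) :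
    ∃ ψ : E ≃ₘ^∞⟮𝓘(ℝ, E), 𝓘(ℝ, E)⟯ E, ⇑ψ = f := by
  have hn : (∞ : WithTop ℕ∞) ≠ 0 := by simp
  let g := Equiv.ofBijective f hb
  have hg : ContDiff ℝ ∞ g.symm := by
    rw [contDiff_iff_contDiffAt]
    intro y
    obtain ⟨x, rfl⟩ := hb.2 y
    let L : E ≃L[ℝ] E :=
      (LinearEquiv.ofInjectiveEndo (fderiv ℝ f x : E →ₗ[ℝ] E) (hd x)).toContinuousLinearEquiv
    have hL : HasFDerivAt f (L : E →L[ℝ] E) x := by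
      have : (L : E →L[ℝ] E) = fderiv ℝ f x := by ext v; rfl
      rw [this]
      exact (hf.differentiable hn x).hasFDerivAt
    have h1 := hf.contDiffAt (x := x)
    -- The smooth local inverse from the inverse function theorem agrees with `g.symm`, because `f`
    -- is injective.
    refine (h1.to_localInverse hL hn).congr_of_eventuallyEq ?_
    filter_upwards [(h1.hasStrictFDerivAt' hL hn).eventually_right_inverse] with z hz
    apply hb.1
    refine Eq.trans ?_ hz.symm
    exact g.apply_symm_apply z
  exact ⟨{ toEquiv := g
           contMDiff_toFun := hf.contMDiff
           contMDiff_invFun := hg.contMDiff }, rfl⟩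

/-- There is a diffeomorphism supported in a ball which shrinks a smaller concentric ball. -/
theorem exists_radial_diffeomorph {a b ε : ℝ} (ha : 0 < a) (hab : a < b) (hε : 0 < ε) :
    ∃ ψ : E ≃ₘ^∞⟮𝓘(ℝ, E), 𝓘(ℝ, E)⟯ E, (∀ v, b ≤ ‖v‖ → ψ v = v) ∧ ∀ v, ‖v‖ ≤ a → ‖ψ v‖ < ε := by
  obtain ⟨c, hc0, hc1, hca⟩ : ∃ c : ℝ, 0 < c ∧ c ≤ 1 ∧ c * a < ε := by
    refine ⟨min 1 (ε / (2 * a)), by positivity, min_le_left _ _, ?_⟩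
    calc min 1 (ε / (2 * a)) * a ≤ ε / (2 * a) * a := by gcongr; exact min_le_right _ _
      _ = ε / 2 := by field_simp
      _ < ε := by linarith
  have hba : 0 < b ^ 2 - a ^ 2 := by nlinarith
  -- The map will be `v ↦ l (‖v‖ ^ 2) • v`: scaling by `c` on the ball of radius `a`, the identity
  -- outside radius `b`. Using the squared norm keeps it smooth at the origin.
  let l : ℝ → ℝ := fun s => c + (1 - c) * Real.smoothTransition ((s - a ^ 2) / (b ^ 2 - a ^ 2))
  have hl : ContDiff ℝ ∞ l := by
    refine contDiff_const.add (contDiff_const.mul (Real.smoothTransition.contDiff.comp ?_))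
    fun_prop
  have hlm : Monotone l := by
    intro s t hst
    have : Real.smoothTransition ((s - a ^ 2) / (b ^ 2 - a ^ 2)) ≤
        Real.smoothTransition ((t - a ^ 2) / (b ^ 2 - a ^ 2)) :=
      Real.smoothTransition.monotone (by gcongr)
    have h1 : 0 ≤ 1 - c := by linarith
    simp only [l]
    gcongr
  have hl0 : ∀ s, 0 < l s := fun s =>
    add_pos_of_pos_of_nonneg hc0 (mul_nonneg (by linarith) (Real.smoothTransition.nonneg _))
  have hlb : ∀ s, b ^ 2 ≤ s → l s = 1 := by
    intro s hs
    have : 1 ≤ (s - a ^ 2) / (b ^ 2 - a ^ 2) := by rw [le_div_iff₀ hba]; linarith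
    simp [l, Real.smoothTransition.one_of_one_le this]
  have hla : ∀ s, s ≤ a ^ 2 → l s = c := by
    intro s hs
    have : (s - a ^ 2) / (b ^ 2 - a ^ 2) ≤ 0 :=
      div_nonpos_of_nonpos_of_nonneg (by linarith) hba.le
    simp [l, Real.smoothTransition.zero_of_nonpos this]
  have hmono : ∀ r s : ℝ, 0 ≤ r → r < s → l (r ^ 2) * r < l (s ^ 2) * s := by
    intro r s hr hrs
    have h1 : l (r ^ 2) ≤ l (s ^ 2) := hlm (by gcongr)
    calc l (r ^ 2) * r ≤ l (s ^ 2) * r := by gcongr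
      _ < l (s ^ 2) * s := by have := hl0 (s ^ 2); gcongr
  let f : E → E := fun v => l (‖v‖ ^ 2) • v
  have hf : ContDiff ℝ ∞ f := (hl.comp (contDiff_norm_sq ℝ)).smul contDiff_id
  have hnorm : ∀ v, ‖f v‖ = l (‖v‖ ^ 2) * ‖v‖ := fun v => by
    rw [norm_smul, Real.norm_eq_abs, abs_of_pos (hl0 _)]
  have hinj : Function.Injective f := by
    intro v w hvw
    have h1 : l (‖v‖ ^ 2) * ‖v‖ = l (‖w‖ ^ 2) * ‖w‖ := by rw [← hnorm, ← hnorm, hvw]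
    have h2 : ‖v‖ = ‖w‖ := by
      rcases lt_trichotomy ‖v‖ ‖w‖ with h | h | h
      · exact absurd h1 (hmono _ _ (norm_nonneg _) h).ne
      · exact h
      · exact absurd h1 (hmono _ _ (norm_nonneg _) h).ne'
    have h3 : l (‖v‖ ^ 2) • v = l (‖w‖ ^ 2) • w := hvw
    rw [h2] at h3
    exact smul_right_injective E (hl0 _).ne' h3
  have hsurj : Function.Surjective f := by
    intro w
    -- Intermediate values along a ray: at `max b ‖w‖` the factor `l` is `1`, so the radial function
    -- is at least `‖w‖` there.
    obtain ⟨t, ⟨ht0, -⟩, ht⟩ : ‖w‖ ∈ (fun t : ℝ => l (t ^ 2) * t) '' Icc 0 (max b ‖w‖) := by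
      refine intermediate_value_Icc (by positivity) ?_ ⟨by simp, ?_⟩
      · have := hl.continuous
        fun_prop
      · rw [hlb _ (pow_le_pow_left₀ (ha.trans hab).le (le_max_left b ‖w‖) 2), one_mul]
        exact le_max_right _ _
    refine ⟨(l (t ^ 2))⁻¹ • w, ?_⟩
    have h1 : ‖(l (t ^ 2))⁻¹ • w‖ = t := by
      rw [norm_smul, norm_inv, Real.norm_eq_abs, abs_of_pos (hl0 _), ← ht]
      exact inv_mul_cancel_left₀ (hl0 _).ne' t
    simp only [f]
    rw [h1, smul_inv_smul₀ (hl0 _).ne']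
  have hder : ∀ x, Function.Injective (fderiv ℝ f x) := by
    intro x
    have hl' : HasDerivAt l (deriv l (‖x‖ ^ 2)) (‖x‖ ^ 2) :=
      (hl.differentiable (by simp) _).hasDerivAt
    have h1 : HasFDerivAt (fun v : E => l (‖v‖ ^ 2))
        (deriv l (‖x‖ ^ 2) • (2 • (innerSL ℝ x : E →L[ℝ] ℝ))) x :=
      HasDerivAt.comp_hasFDerivAt (h₂ := l) (f := fun v : E => ‖v‖ ^ 2) x hl'
        (hasStrictFDerivAt_norm_sq x).hasFDerivAt
    have h2 := h1.smul (hasFDerivAt_id x)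
    rw [show fderiv ℝ f x = _ from h2.fderiv]
    rw [injective_iff_map_eq_zero]
    intro w hw
    have hpos : 0 ≤ deriv l (‖x‖ ^ 2) := hlm.deriv_nonneg
    set l' := deriv l (‖x‖ ^ 2)
    have h3 : l (‖x‖ ^ 2) • w + (l' * (2 * inner ℝ x w)) • x = 0 := by
      simpa using hw
    -- Pairing the kernel equation with `x` gives a positive multiple of `inner ℝ x w`, as `l > 0`
    -- and `l' ≥ 0`. So `w` is orthogonal to `x`, and the equation reduces to `l (‖x‖ ^ 2) • w = 0`.
    have h4 : l (‖x‖ ^ 2) * inner ℝ x w + l' * (2 * inner ℝ x w) * ‖x‖ ^ 2 = 0 := by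
      have := congrArg (fun z => inner ℝ x z) h3
      simpa [inner_add_right, inner_smul_right] using this
    have h5 : inner ℝ x w = 0 := by
      have h6 : (l (‖x‖ ^ 2) + 2 * l' * ‖x‖ ^ 2) * inner ℝ x w = 0 := by linarith
      have h7 : 0 < l (‖x‖ ^ 2) + 2 * l' * ‖x‖ ^ 2 :=
        add_pos_of_pos_of_nonneg (hl0 _) (by positivity)
      exact (mul_eq_zero.1 h6).resolve_left h7.ne'
    rw [h5] at h3
    simp only [mul_zero, zero_smul, add_zero] at h3
    exact (smul_eq_zero.1 h3).resolve_left (hl0 _).ne'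
  obtain ⟨ψ, hψ⟩ := exists_diffeomorph_of_bijective hf ⟨hinj, hsurj⟩ hder
  refine ⟨ψ, fun v hv => ?_, fun v hv => ?_⟩
  · rw [hψ]
    simp only [f]
    rw [hlb _ (pow_le_pow_left₀ (ha.trans hab).le hv 2), one_smul]
  · rw [hψ, hnorm, hla _ (by gcongr)]
    exact (mul_le_mul_of_nonneg_left hv hc0.le).trans_lt hca

/-- A diffeomorphism supported near the unit ball which moves the unit ball into a given open set
that comes close to the origin. -/
theorem exists_diffeomorph_closedBall_subset {δ : ℝ} (hδ : 0 < δ) {O : Set E} (hO : IsOpen O)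
    (hne : (O ∩ ball 0 (δ / 4)).Nonempty) :
    ∃ ψ : E ≃ₘ^∞⟮𝓘(ℝ, E), 𝓘(ℝ, E)⟯ E, (∀ v ∉ closedBall (0 : E) (1 + 3 * δ / 4), ψ v = v) ∧
      ∀ v ∈ closedBall (0 : E) 1, ψ v ∈ O := by
  obtain ⟨p, hpO, hp⟩ := hne
  rw [mem_ball_zero_iff] at hp
  obtain ⟨ε, hε, hεO⟩ := Metric.isOpen_iff.1 hO p hpO
  -- `R` will be recentred at `p`. Since `‖p‖ < δ / 4`, the unit ball lies within `1 + δ / 4` of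
  -- `p`, and the points within `1 + δ / 2` of `p` have norm at most `1 + 3 * δ / 4`.
  obtain ⟨R, hR, hRε⟩ := exists_radial_diffeomorph (E := E) (a := 1 + δ / 4) (b := 1 + δ / 2)
    (by positivity) (by linarith) hε
  let T : E ≃ₘ^∞⟮𝓘(ℝ, E), 𝓘(ℝ, E)⟯ E :=
    { toEquiv := Equiv.subRight p
      contMDiff_toFun := (contDiff_id.sub contDiff_const).contMDiff
      contMDiff_invFun := (contDiff_id.add contDiff_const).contMDiff }
  have hT : ∀ v, T v = v - p := fun _ => rfl
  have hT' : ∀ v, T.symm v = v + p := fun _ => rfl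
  refine ⟨(T.trans R).trans T.symm, fun v hv => ?_, fun v hv => ?_⟩
  · simp only [Diffeomorph.coe_trans, Function.comp_apply, hT, hT']
    rw [mem_closedBall_zero_iff, not_le] at hv
    rw [hR _ (by linarith [norm_sub_norm_le v p]), sub_add_cancel]
  · simp only [Diffeomorph.coe_trans, Function.comp_apply, hT, hT']
    rw [mem_closedBall_zero_iff] at hv
    apply hεO
    rw [mem_ball_iff_norm, add_sub_cancel_right]
    exact hRε _ (by linarith [norm_sub_le v p])

end Radial

/-! ### Separating a locally finite family of compact sets. -/

/-- A locally finite family of pairwise disjoint compact sets has a locally finite family of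
pairwise disjoint open neighbourhoods. -/
theorem exists_locallyFinite_disjoint_nhds {X ι : Type*} [TopologicalSpace X]
    [TopologicalSpace.MetrizableSpace X] [SigmaCompactSpace X] {S : ι → Set X}
    (hc : ∀ i, IsCompact (S i)) (hne : ∀ i, (S i).Nonempty)
    (hd : Pairwise (Function.onFun Disjoint S)) (hlf : LocallyFinite S) :
    ∃ W : ι → Set X, (∀ i, IsOpen (W i)) ∧ (∀ i, S i ⊆ W i) ∧
      Pairwise (Function.onFun Disjoint W) ∧ LocallyFinite W := by
  let _ := TopologicalSpace.metrizableSpaceMetric X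
  have hcount : Countable ι := countable_univ_iff.1 (hlf.countable_univ hne)
  let _ := Encodable.ofCountable ι
  have hT : ∀ i, IsClosed (⋃ k : {k // k ≠ i}, S k.1) := fun i =>
    LocallyFinite.isClosed_iUnion (f := fun k : {k // k ≠ i} => S k.1)
      (hlf.comp_injective Subtype.val_injective) fun k => (hc k.1).isClosed
  have hdis : ∀ i, Disjoint (S i) (⋃ k : {k // k ≠ i}, S k.1) := fun i =>
    disjoint_iUnion_right.2 fun k => hd k.2.symm
  choose δ hδ hδd using fun i => (hdis i).exists_thickenings (hc i) (hT i)
  -- The bound `δ i / 2` makes the thickenings disjoint: where two meet, the sum of the radii is at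
  -- most the `δ` of the larger one. The bound `1 / (encode i + 1)` gives local finiteness, since
  -- all but finitely many radii are small.
  let r : ι → ℝ := fun i => min (δ i / 2) (1 / (Encodable.encode i + 1))
  have hr : ∀ i, 0 < r i := fun i => lt_min (by linarith [hδ i]) (by positivity)
  have key : ∀ i k, i ≠ k → r i ≤ r k → Disjoint (thickening (r i) (S i))
      (thickening (r k) (S k)) := by
    intro i k hik hle
    rw [disjoint_left]
    intro z hz hz'
    obtain ⟨x, hx, hzx⟩ := mem_thickening_iff.1 hz
    obtain ⟨y, hy, hzy⟩ := mem_thickening_iff.1 hz'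
    have h1 : dist x y < δ k := by
      have h2 : r k ≤ δ k / 2 := min_le_left _ _
      linarith [dist_triangle_left x y z]
    exact (hδd k).le_bot ⟨mem_thickening_iff.2 ⟨y, hy, h1⟩,
      self_subset_thickening (hδ k) _ (mem_iUnion.2 ⟨⟨i, hik⟩, hx⟩)⟩
  refine ⟨fun i => thickening (r i) (S i), fun i => isOpen_thickening,
    fun i => self_subset_thickening (hr i) _, fun i k hik => ?_, fun x => ?_⟩
  · rcases le_total (r i) (r k) with h | h
    · exact key i k hik h
    · exact (key k i hik.symm h).symm
  · obtain ⟨U, hU, hfin⟩ := hlf x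
    obtain ⟨ρ, hρ, hρU⟩ := Metric.mem_nhds_iff.1 hU
    obtain ⟨n, hn⟩ := exists_nat_one_div_lt (half_pos hρ)
    have hfin' : {i : ι | Encodable.encode i < n}.Finite :=
      (finite_lt_nat n).preimage Encodable.encode_injective.injOn
    refine ⟨ball x (ρ / 2), ball_mem_nhds _ (half_pos hρ), (hfin.union hfin').subset ?_⟩
    rintro i ⟨z, hz, hzx⟩
    by_cases hi : Encodable.encode i < n
    · exact Or.inr hi
    · refine Or.inl ?_
      obtain ⟨y, hy, hzy⟩ := mem_thickening_iff.1 hz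
      refine ⟨y, hy, hρU ?_⟩
      have h1 : r i ≤ 1 / ((n : ℝ) + 1) := by
        refine (min_le_right _ _).trans ?_
        have : (n : ℝ) ≤ Encodable.encode i := by exact_mod_cast not_lt.1 hi
        gcongr
      rw [mem_ball] at hzx ⊢
      linarith [dist_triangle_left y x z]

namespace ThreeManifold

variable {M M' N P : ThreeManifold.{u}}

instance (M : ThreeManifold.{u}) : TopologicalSpace.MetrizableSpace M :=
  haveI : LocallyCompactSpace M := ChartedSpace.locallyCompactSpace (EuclideanSpace ℝ (Fin 3)) M
  inferInstance

instance (M : ThreeManifold.{u}) : SigmaCompactSpace M :=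
  haveI : LocallyCompactSpace M := ChartedSpace.locallyCompactSpace (EuclideanSpace ℝ (Fin 3)) M
  inferInstance

theorem nonempty_S2 : Nonempty S2 := ⟨⟨EuclideanSpace.single 0 1, by simp⟩⟩

theorem nonempty_sphereOf (τ : TubeMap M) : (sphereOf τ).Nonempty :=
  let ⟨v⟩ := nonempty_S2
  ⟨τ (v, 0), (v, 0), ⟨mem_univ _, rfl⟩, rfl⟩

/-! ### Thin tubes and disjoint caps. -/

namespace Capping

variable {ι κ : Type u}

/-- The tubes can be made pairwise disjoint and locally finite. -/
theorem exists_thin (c : Capping M P ι) : ∃ c' : Capping M P ι,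
    Pairwise (Function.onFun Disjoint fun i => (c'.τ i).target) ∧
    LocallyFinite fun i => (c'.τ i).target := by
  obtain ⟨W, hWo, hSW, hWd, hWf⟩ := exists_locallyFinite_disjoint_nhds c.isCompact_sphere
    (fun i => nonempty_sphereOf (c.τ i))
    (fun i k hik => (c.tube_disjoint i k hik).mono_left (c.sphere_subset i)) c.locallyFinite
  choose ε hε hεW using fun i => c.exists_tube_subset i (hWo i) (hSW i)
  let c' := c.shrink (fun i => min (ε i) (c.δ i)) (fun i => lt_min (hε i) (c.δ_pos i))
    fun i => min_le_right _ _
  have h : ∀ i, (c'.τ i).target ⊆ W i := by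
    intro i x hx
    obtain ⟨v, t, ht, rfl⟩ := c'.mem_tube_iff.1 hx
    exact hεW i v t (lt_of_lt_of_le ht (min_le_left _ _))
  exact ⟨c', fun i k hik => (hWd hik).mono (h i) (h k), hWf.subset h⟩

variable (c : Capping M P ι)

/-- Disjointness of the tubes determines the sphere, and the sign of the normal coordinate
determines the side. -/
theorem eq_of_tube_eq (hd : Pairwise (Function.onFun Disjoint fun i => (c.τ i).target))
    {a b : ι × Bool} {v w : S2} {s t : ℝ} (hs : 0 < s) (hs' : s < c.δ a.1) (ht : 0 < t)
    (ht' : t < c.δ b.1) (h : c.τ a.1 (v, side a.2 * s) = c.τ b.1 (w, side b.2 * t)) : a = b := by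
  obtain ⟨i, x⟩ := a
  obtain ⟨k, y⟩ := b
  have h1 : (v, side x * s) ∈ (c.τ i).source :=
    c.mem_source.2 (by rwa [abs_side_mul, abs_of_pos hs])
  have h2 : (w, side y * t) ∈ (c.τ k).source :=
    c.mem_source.2 (by rwa [abs_side_mul, abs_of_pos ht])
  by_cases hik : i = k
  · subst hik
    have := (Prod.ext_iff.1 ((c.τ i).injOn' h1 h2 h)).2
    cases x <;> cases y <;> simp [side] at this ⊢ <;> linarith
  · refine ((hd hik).le_bot ⟨(c.τ i).apply_mem h1, ?_⟩).elim
    dsimp only at h ⊢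
    rw [h]
    exact (c.τ k).apply_mem h2

theorem eq_of_e_tube_eq (hd : Pairwise (Function.onFun Disjoint fun i => (c.τ i).target))
    {a b : ι × Bool} {v w : S2} {s t : ℝ} (hs : 0 < s) (hs' : s < c.δ a.1) (ht : 0 < t)
    (ht' : t < c.δ b.1) (h : c.e (c.τ a.1 (v, side a.2 * s)) = c.e (c.τ b.1 (w, side b.2 * t))) :
    a = b := by
  have key : ∀ {i : ι} {x : Bool} {v : S2} {s : ℝ}, 0 < s → s < c.δ i →
      c.τ i (v, side x * s) ∈ c.e.source := by
    intro i x v s hs hs'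
    refine c.tube_mem_e_source (by rwa [abs_side_mul, abs_of_pos hs]) ?_
    rw [← abs_pos, abs_side_mul]
    exact abs_pos.2 hs.ne'
  exact c.eq_of_tube_eq hd hs hs' ht ht' (c.e.injOn' (key hs hs') (key ht ht') h)

theorem collar_notMem_ball {i : ι} {b : Bool} {v : S2} {t : ℝ} (h0 : 0 < t) (ht : t < c.δ i)
    (a : ι × Bool) : c.e (c.τ i (v, side b * t)) ∉ ballOf (c.φ a.1 a.2) := by
  intro h
  have h1 : c.τ i (v, side b * t) ∈ c.e.source := by
    refine c.tube_mem_e_source (by rwa [abs_side_mul, abs_of_pos h0]) ?_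
    rw [← abs_pos, abs_side_mul]
    exact abs_pos.2 h0.ne'
  have h2 := c.e.apply_mem h1
  rw [c.e_target] at h2
  exact h2 (mem_iUnion.2 ⟨a, h⟩)

/-- If two balls coincided, points just outside the first would lie in the open cap around the
second but not in the ball, hence in both collars. Collars of different sides are disjoint. -/
theorem ball_disjoint (hd : Pairwise (Function.onFun Disjoint fun i => (c.τ i).target))
    {a b : ι × Bool} (hab : a ≠ b) : Disjoint (ballOf (c.φ a.1 a.2)) (ballOf (c.φ b.1 b.2)) := by
  refine (c.ball_eq_or_disjoint a b).resolve_left fun h => hab ?_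
  obtain ⟨ε, hε, hεW⟩ := c.exists_cap_subset a.1 a.2 (c.φ b.1 b.2).open_target
    (h.le.trans (c.ball_subset b.1 b.2))
  obtain ⟨v⟩ := nonempty_S2
  obtain ⟨t, h0, ht⟩ := exists_between (lt_min hε (c.δ_pos a.1))
  have ht1 := ht.trans_le (min_le_left _ _)
  have ht2 := ht.trans_le (min_le_right _ _)
  have h1 := hεW _ (polar_mem_ball h0 ht1 v)
  rw [c.collar a.1 a.2 v t h0 ht2] at h1
  rcases c.mem_cap_iff.1 h1 with h2 | ⟨w, s, hs, hs', h2⟩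
  · exact (c.collar_notMem_ball h0 ht2 b h2).elim
  · exact (c.eq_of_e_tube_eq hd hs hs' h0 ht2 h2).symm

theorem cap_disjoint (hd : Pairwise (Function.onFun Disjoint fun i => (c.τ i).target)) :
    Pairwise (Function.onFun Disjoint fun a : ι × Bool => (c.φ a.1 a.2).target) := by
  intro a b hab
  rw [Function.onFun, disjoint_left]
  intro y hy hy'
  rcases c.mem_cap_iff.1 hy with h1 | ⟨v, s, hs, hs', rfl⟩ <;>
  rcases c.mem_cap_iff.1 hy' with h2 | ⟨w, t, ht, ht', h2⟩
  · exact (c.ball_disjoint hd hab).le_bot ⟨h1, h2⟩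
  · rw [← h2] at h1
    exact c.collar_notMem_ball ht ht' a h1
  · exact c.collar_notMem_ball hs hs' b h2
  · exact hab (c.eq_of_e_tube_eq hd ht ht' hs hs' h2).symm

/-- Away from the balls, `c.e` transports the local finiteness of the tubes. At a point of a ball,
the open cap around it meets no other cap. -/
theorem cap_locallyFinite (hd : Pairwise (Function.onFun Disjoint fun i => (c.τ i).target))
    (hlf : LocallyFinite fun i => (c.τ i).target) :
    LocallyFinite fun a : ι × Bool => (c.φ a.1 a.2).target := by
  intro x
  by_cases hx : x ∈ c.e.target
  · obtain ⟨U, hU, hfin⟩ := hlf (c.e.symm x)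
    refine ⟨c.e.target ∩ c.e.symm ⁻¹' U, Filter.inter_mem (c.e.open_target.mem_nhds hx)
      ((c.e.symm.continuousOn'.continuousAt (c.e.open_target.mem_nhds hx)) hU),
      (hfin.prod finite_univ).subset ?_⟩
    rintro a ⟨z, hz, hze, hzU⟩
    refine ⟨?_, mem_univ _⟩
    rcases c.mem_cap_iff.1 hz with h | ⟨v, t, h0, ht, rfl⟩
    · rw [c.e_target] at hze
      exact (hze (mem_iUnion.2 ⟨a, h⟩)).elim
    · have h1 : |side a.2 * t| < c.δ a.1 := by rwa [abs_side_mul, abs_of_pos h0]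
      have h2 : side a.2 * t ≠ 0 := by
        rw [← abs_pos, abs_side_mul]
        exact abs_pos.2 h0.ne'
      rw [mem_preimage, c.e.symm_apply_apply (c.tube_mem_e_source h1 h2)] at hzU
      exact ⟨_, c.mem_tube_iff.2 ⟨v, _, h1, rfl⟩, hzU⟩
  · rw [c.e_target, notMem_compl_iff] at hx
    obtain ⟨a, ha⟩ := mem_iUnion.1 hx
    refine ⟨_, (c.φ a.1 a.2).open_target.mem_nhds (c.ball_subset _ _ ha),
      (finite_singleton a).subset ?_⟩
    rintro b ⟨z, hz, hz'⟩
    by_contra hba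
    exact (c.cap_disjoint hd hba).le_bot ⟨hz, hz'⟩

end Capping

/-! ### Gluing diffeomorphisms supported in disjoint charts. -/

section Glue

variable {α : Type*} {φ : α → BallMap P} {R r : α → ℝ}

open Classical in
/-- Apply the map `ψ a` in the image of the chart `φ a`, for every `a`. -/
def glueFun (φ : α → BallMap P)
    (ψ : α → EuclideanSpace ℝ (Fin 3) → EuclideanSpace ℝ (Fin 3)) (x : P) : P :=
  if h : ∃ a, x ∈ (φ a).target then φ h.choose (ψ h.choose ((φ h.choose).symm x)) else x

theorem glueFun_apply (hd : Pairwise (Function.onFun Disjoint fun a => (φ a).target))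
    (ψ : α → EuclideanSpace ℝ (Fin 3) → EuclideanSpace ℝ (Fin 3)) {a : α}
    {z : EuclideanSpace ℝ (Fin 3)} (hz : z ∈ (φ a).source) :
    glueFun φ ψ (φ a z) = φ a (ψ a z) := by
  have h : ∃ b, φ a z ∈ (φ b).target := ⟨a, (φ a).apply_mem hz⟩
  have hb : h.choose = a := by
    by_contra hne
    exact (hd hne).le_bot ⟨h.choose_spec, (φ a).apply_mem hz⟩
  rw [glueFun, dif_pos h, hb, (φ a).symm_apply_apply hz]

theorem glueFun_of_notMem (ψ : α → EuclideanSpace ℝ (Fin 3) → EuclideanSpace ℝ (Fin 3)) {x : P}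
    (hx : ∀ a, x ∉ (φ a).target) : glueFun φ ψ x = x := by
  rw [glueFun, dif_neg (by simpa using hx)]

theorem contMDiff_glueFun (hd : Pairwise (Function.onFun Disjoint fun a => (φ a).target))
    (hlf : LocallyFinite fun a => (φ a).target) (hR : ∀ a, (φ a).source = ball 0 (R a))
    (hr : ∀ a, r a < R a) {ψ : α → EuclideanSpace ℝ (Fin 3) → EuclideanSpace ℝ (Fin 3)}
    (hψ : ∀ a, ContDiff ℝ ∞ (ψ a)) (hm : ∀ a, ∀ z ∈ (φ a).source, ψ a z ∈ (φ a).source)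
    (hid : ∀ a, ∀ z ∉ closedBall 0 (r a), ψ a z = z) :
    ContMDiff (𝓡 3) (𝓡 3) ∞ (glueFun φ ψ) := by
  intro x
  by_cases hx : ∃ a, x ∈ (φ a).target
  · obtain ⟨a, ha⟩ := hx
    have h1 : ContMDiffOn (𝓡 3) (𝓡 3) ∞ (fun y => φ a (ψ a ((φ a).symm y))) (φ a).target :=
      (φ a).contMDiffOn.comp ((hψ a).contMDiff.comp_contMDiffOn (φ a).symm.contMDiffOn)
        fun y hy => hm a _ ((φ a).symm_apply_mem hy)
    refine (h1.contMDiffAt ((φ a).open_target.mem_nhds ha)).congr_of_eventuallyEq ?_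
    filter_upwards [(φ a).open_target.mem_nhds ha] with y hy
    have := glueFun_apply hd ψ ((φ a).symm_apply_mem hy)
    rwa [(φ a).apply_symm_apply hy] at this
  -- The supports are compact and locally finite, so their union is closed; a point outside all
  -- charts thus has a neighbourhood where the glued map is the identity.
  · have hK : IsClosed (⋃ a, φ a '' closedBall 0 (r a)) := by
      refine LocallyFinite.isClosed_iUnion (hlf.subset fun a => ?_) fun a => ?_
      · rintro _ ⟨z, hz, rfl⟩
        refine (φ a).apply_mem ?_
        rw [hR]
        exact closedBall_subset_ball (hr a) hz
      · refine ((isCompact_closedBall _ _).image_of_continuousOn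
          ((φ a).continuousOn'.mono ?_)).isClosed
        rw [hR]
        exact closedBall_subset_ball (hr a)
    have hxK : x ∈ (⋃ a, φ a '' closedBall 0 (r a))ᶜ := by
      intro h
      obtain ⟨a, z, hz, rfl⟩ := mem_iUnion.1 h
      refine hx ⟨a, (φ a).apply_mem ?_⟩
      rw [hR]
      exact closedBall_subset_ball (hr a) hz
    refine contMDiffAt_id.congr_of_eventuallyEq ?_
    filter_upwards [hK.isOpen_compl.mem_nhds hxK] with y hy
    by_cases hy' : ∃ a, y ∈ (φ a).target
    · obtain ⟨a, ha⟩ := hy'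
      rw [PartialDiffeomorph.target_eq_image] at ha
      obtain ⟨z, hz, rfl⟩ := ha
      rw [glueFun_apply hd ψ hz, hid a z fun hz' => hy (mem_iUnion.2 ⟨a, z, hz', rfl⟩), id]
    · exact glueFun_of_notMem ψ (by simpa using hy')

/-- Diffeomorphisms of `ℝ³` supported in disjoint charts of `P` define a diffeomorphism of `P`. -/
theorem exists_glued_diffeomorph (hd : Pairwise (Function.onFun Disjoint fun a => (φ a).target))
    (hlf : LocallyFinite fun a => (φ a).target) (hR : ∀ a, (φ a).source = ball 0 (R a))
    (hr : ∀ a, r a < R a)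
    (ψ : α → EuclideanSpace ℝ (Fin 3) ≃ₘ^∞⟮𝓡 3, 𝓡 3⟯ EuclideanSpace ℝ (Fin 3))
    (hid : ∀ a, ∀ z ∉ closedBall 0 (r a), ψ a z = z) :
    ∃ g : P ≃ₘ^∞⟮𝓡 3, 𝓡 3⟯ P, ∀ a, ∀ z ∈ (φ a).source, g (φ a z) = φ a (ψ a z) := by
  have hid' : ∀ a, ∀ z ∉ closedBall 0 (r a), (ψ a).symm z = z := by
    intro a z hz
    conv_lhs => rw [← hid a z hz]
    exact (ψ a).symm_apply_apply z
  have hnb : ∀ a, ∀ z ∉ (φ a).source, z ∉ closedBall 0 (r a) := fun a z hz h => by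
    rw [hR] at hz
    exact hz (closedBall_subset_ball (hr a) h)
  have hm : ∀ a, ∀ z ∈ (φ a).source, ψ a z ∈ (φ a).source := by
    intro a z hz
    by_contra h
    -- If `ψ a z` lay outside the chart domain, `ψ a` would fix it, and injectivity would give `ψ a
    -- z = z`.
    have h1 : ψ a z = z := (ψ a).injective (hid a _ (hnb a _ h))
    exact h (h1.symm ▸ hz)
  have hm' : ∀ a, ∀ z ∈ (φ a).source, (ψ a).symm z ∈ (φ a).source := by
    intro a z hz
    by_contra h
    have h1 : (ψ a).symm z = z := (ψ a).symm.injective (hid' a _ (hnb a _ h))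
    exact h (h1.symm ▸ hz)
  have hinv : ∀ f g : α → EuclideanSpace ℝ (Fin 3) → EuclideanSpace ℝ (Fin 3),
      (∀ a, ∀ z ∈ (φ a).source, f a z ∈ (φ a).source) → (∀ a z, g a (f a z) = z) →
      ∀ x, glueFun φ g (glueFun φ f x) = x := by
    intro f g hf hgf x
    by_cases hx : ∃ a, x ∈ (φ a).target
    · obtain ⟨a, ha⟩ := hx
      rw [PartialDiffeomorph.target_eq_image] at ha
      obtain ⟨z, hz, rfl⟩ := ha
      rw [glueFun_apply hd f hz, glueFun_apply hd g (hf a z hz), hgf]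
    · have hx' : ∀ a, x ∉ (φ a).target := by simpa using hx
      rw [glueFun_of_notMem f hx', glueFun_of_notMem g hx']
  exact ⟨{
    toFun := glueFun φ fun a => ψ a
    invFun := glueFun φ fun a => (ψ a).symm
    left_inv := hinv _ _ hm fun a z => (ψ a).symm_apply_apply z
    right_inv := hinv _ _ hm' fun a z => (ψ a).apply_symm_apply z
    contMDiff_toFun := contMDiff_glueFun hd hlf hR hr (fun a => (ψ a).contMDiff.contDiff) hm hid
    contMDiff_invFun := contMDiff_glueFun hd hlf hR hr
      (fun a => (ψ a).symm.contMDiff.contDiff) hm' hid' }, fun a z hz =>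
    glueFun_apply hd (fun a => ψ a) hz⟩

end Glue

variable {A : ThreeManifold.{u}} {ι κ : Type u} {𝒳 : Set ThreeManifold.{u}}

/-! ### Moving the caps off the second family of spheres. -/

namespace Capping

/-- The spheres have empty interior. -/
theorem interior_iUnion_sphere (c : Capping M P ι) : interior (⋃ i, sphereOf (c.τ i)) = ∅ := by
  refine eq_empty_of_forall_notMem fun x hx => ?_
  obtain ⟨i, ⟨v, s⟩, ⟨-, hs⟩, rfl⟩ := mem_iUnion.1 (interior_subset hx)
  obtain rfl : s = 0 := hs
  have h0 : (v, (0 : ℝ)) ∈ (c.τ i).source := c.mem_source.2 (by simpa using c.δ_pos i)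
  have hopen := (c.τ i).isOpen_preimage (isOpen_interior (s := ⋃ i, sphereOf (c.τ i)))
  obtain ⟨ε, hε, h⟩ := Metric.isOpen_iff.1 hopen (v, 0) ⟨h0, hx⟩
  have h1 : (v, ε / 2) ∈ ball (v, (0 : ℝ)) ε := by
    rw [mem_ball, Prod.dist_eq, dist_self, Real.dist_eq, sub_zero, abs_of_pos (half_pos hε)]
    exact max_lt hε (half_lt_self hε)
  have h2 := c.tube_mem_e_source (v := v) (c.mem_source.1 (h h1).1) (half_pos hε).ne'
  rw [c.e_source] at h2
  exact h2 (interior_subset (h h1).2)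

/-- The caps can be moved away from any closed set with empty interior. -/
theorem exists_ball_disjoint (c : Capping M P ι) {K : Set P} (hK : IsClosed K)
    (hK' : interior K = ∅) :
    ∃ (κ : Type u) (c' : Capping M P κ), ∀ i b, Disjoint (ballOf (c'.φ i b)) K := by
  obtain ⟨c, hd, hlf⟩ := c.exists_thin
  -- Since `K` has no interior, it cannot contain the image of the ball of radius `δ / 4` about the
  -- centre of a cap.
  have hO : ∀ a : ι × Bool, (((c.φ a.1 a.2).source ∩ c.φ a.1 a.2 ⁻¹' Kᶜ) ∩
      ball 0 (c.δ a.1 / 4)).Nonempty := by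
    intro a
    have hδ := c.δ_pos a.1
    by_contra hne
    rw [not_nonempty_iff_eq_empty] at hne
    have hsub : ball 0 (c.δ a.1 / 4) ⊆ (c.φ a.1 a.2).source := by
      rw [c.φ_source]
      exact ball_subset_ball (by linarith)
    have h1 : c.φ a.1 a.2 '' ball 0 (c.δ a.1 / 4) ⊆ interior K := by
      refine interior_maximal ?_ ((c.φ a.1 a.2).isOpen_image isOpen_ball hsub)
      rintro _ ⟨z, hz, rfl⟩
      by_contra hzK
      exact (hne.le ⟨⟨hsub hz, hzK⟩, hz⟩ : z ∈ (∅ : Set _))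
    rw [hK'] at h1
    exact h1 ⟨0, mem_ball_self (by linarith), rfl⟩
  choose ψ hψ hψO using fun a : ι × Bool => exists_diffeomorph_closedBall_subset (c.δ_pos a.1)
    ((c.φ a.1 a.2).isOpen_preimage hK.isOpen_compl) (hO a)
  obtain ⟨g, hg⟩ := exists_glued_diffeomorph (φ := fun a : ι × Bool => c.φ a.1 a.2)
    (R := fun a => 1 + c.δ a.1) (r := fun a => 1 + 3 * c.δ a.1 / 4) (c.cap_disjoint hd)
    (c.cap_locallyFinite hd hlf) (fun a => c.φ_source _ _)
    (fun a => by linarith [c.δ_pos a.1]) ψ hψ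
  -- The spheres in `M` stay put, while `c.e` and the caps are composed with `g`. The new balls are
  -- the images of the old ones under `g`, so they lie in the complement of `K`.
  refine ⟨_, c.pullback (Diffeomorph.refl (𝓡 3) M ∞).toPartialDiffeomorph
    g.symm.toPartialDiffeomorph (fun _ => True) rfl rfl (fun _ _ _ _ => mem_univ _) (by simp)
    (fun _ _ _ _ _ => mem_univ _) (by simp) (fun _ _ => iff_of_true (mem_univ _) (mem_univ _)),
    fun i b => ?_⟩
  rw [disjoint_left]
  rintro _ ⟨z, hz, rfl⟩ hzK
  have h1 : g (c.φ i b z) ∈ K := hzK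
  have h2 : z ∈ (c.φ i b).source := by
    rw [c.φ_source]
    exact closedBall_subset_ball (by linarith [c.δ_pos i]) hz
  rw [hg (i, b) z h2] at h1
  exact (hψO (i, b) z hz).2 h1

/-- The balls of `c` and the spheres of `d` are compact, so when they are disjoint, thinner tubes
and collars are disjoint from them too, which is what `comp` needs. -/
theorem exists_comp (c : Capping M P ι) (d : Capping P N κ)
    (h : ∀ i b, Disjoint (ballOf (c.φ i b)) (⋃ k, sphereOf (d.τ k))) :
    Nonempty (Capping M N (ι ⊕ κ)) := by
  have hb : ∀ i b, ballOf (c.φ i b) ⊆ d.e.source := fun i b => by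
    rw [d.e_source]
    exact (h i b).subset_compl_right
  have hs : ∀ k, sphereOf (d.τ k) ⊆ c.e.target := by
    intro k x hx
    rw [c.e_target]
    intro hx'
    obtain ⟨a, ha⟩ := mem_iUnion.1 hx'
    exact (h a.1 a.2).le_bot ⟨ha, mem_iUnion.2 ⟨k, hx⟩⟩
  choose ε hε hεb using fun i b => c.exists_cap_subset i b d.e.open_source (hb i b)
  choose η hη hηs using fun k => d.exists_tube_subset k c.e.open_target (hs k)
  let c' := c.shrink (fun i => min (min (ε i true) (ε i false)) (c.δ i))
    (fun i => lt_min (lt_min (hε _ _) (hε _ _)) (c.δ_pos i)) fun i => min_le_right _ _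
  let d' := d.shrink (fun k => min (η k) (d.δ k)) (fun k => lt_min (hη _) (d.δ_pos k))
    fun k => min_le_right _ _
  refine ⟨c'.comp d' (fun i b => ?_) fun k x hx => ?_⟩
  · rw [PartialDiffeomorph.target_eq_image, c'.φ_source]
    rintro _ ⟨z, hz, rfl⟩
    refine hεb i b z (ball_subset_ball ?_ hz)
    have h1 : min (min (ε i true) (ε i false)) (c.δ i) ≤ ε i b := by
      refine (min_le_left _ _).trans ?_
      cases b
      exacts [min_le_right _ _, min_le_left _ _]
    exact add_le_add_right h1 1
  · obtain ⟨v, t, ht, rfl⟩ := d'.mem_tube_iff.1 hx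
    exact hηs k v t (lt_of_lt_of_le ht (min_le_left _ _))

/-- If splitting `M` yields a connected sum, then `M` is a connected sum. -/
theorem isConnectedSum (c : Capping M P ι) (h : IsConnectedSum 𝒳 P) : IsConnectedSum 𝒳 M := by
  obtain ⟨N, κ, ⟨d⟩, hN⟩ := isConnectedSum_iff.1 h
  obtain ⟨ι', c', hc'⟩ := c.exists_ball_disjoint d.isClosed_iUnion_sphere d.interior_iUnion_sphere
  exact isConnectedSum_iff.2 ⟨N, _, c'.exists_comp d hc', hN⟩

end Capping

/-! ### Connected components and how splitting acts on them. -/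

instance (M : ThreeManifold.{u}) : LocallyConnectedSpace M :=
  ChartedSpace.locallyConnectedSpace (EuclideanSpace ℝ (Fin 3)) M

instance (M : ThreeManifold.{u}) : Countable (ConnectedComponents M) := by
  obtain ⟨s, hs, hd⟩ := TopologicalSpace.exists_countable_dense M
  have := hs.to_subtype
  refine Function.Surjective.countable (f := fun x : s => (x.1 : ConnectedComponents M)) fun q => ?_
  obtain ⟨x, rfl⟩ := ConnectedComponents.surjective_coe q
  -- Components are open, so each contains a point of the countable dense set.
  obtain ⟨y, hy, hys⟩ := hd.exists_mem_open (M.isOpen_connectedComponent x)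
    ⟨x, mem_connectedComponent⟩
  exact ⟨⟨y, hy⟩, ConnectedComponents.coe_eq_coe'.2 hys⟩

instance (M : ThreeManifold.{u}) (x : M) : Nonempty (M.component x) :=
  ⟨(⟨x, mem_connectedComponent⟩ : connectedComponent x)⟩

/-- A nonempty manifold is a connected sum if its components are. -/
theorem isConnectedSum_of_component [Nonempty P] (h : ∀ x : P, IsConnectedSum 𝒳 (P.component x)) :
    IsConnectedSum 𝒳 P := by
  let X : ConnectedComponents P → ThreeManifold.{u} := fun q => P.component q.out
  have hX : IsConnectedSum 𝒳 (sigma X) := by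
    have hne : ∀ q, Nonempty (X q) := fun q => inferInstanceAs (Nonempty (P.component q.out))
    choose Y ι c hY using fun q : ConnectedComponents P => isConnectedSum_iff.1 (h q.out)
    exact isConnectedSum_iff.2 ⟨sigma Y, _, exists_sigma_capping fun q => (c q).some,
      isDisjointUnionOf_sigma hY⟩
  have hmk : ∀ (q : ConnectedComponents P) (y : P),
      y ∈ connectedComponent q.out ↔ (y : ConnectedComponents P) = q := by
    intro q y
    rw [← ConnectedComponents.coe_eq_coe']
    exact iff_of_eq (congrArg _ (Quotient.out_eq q))
  let F : sigma X → P := fun z : Σ q, X q => P.componentVal _ z.2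
  have hF : ∀ q y, F (sigmaIncl X q y) = P.componentVal _ y := fun _ _ => rfl
  have hq : ∀ q (y : X q), (P.componentVal _ y : ConnectedComponents P) = q := fun q y =>
    (hmk q _).1 (P.range_componentVal _ ▸ mem_range_self y)
  have hinj : Function.Injective F := by
    intro z w hzw
    obtain ⟨q, y, rfl⟩ := sigma_cases z
    obtain ⟨q', y', rfl⟩ := sigma_cases w
    rw [hF, hF] at hzw
    obtain rfl : q = q' := by rw [← hq q y, ← hq q' y', hzw]
    rw [(P.isOpenEmb_componentVal _).1 hzw]
  have hsurj : range F = univ := by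
    refine eq_univ_of_forall fun y => ?_
    have h1 : y ∈ range (P.componentVal (y : ConnectedComponents P).out) := by
      rw [range_componentVal]
      exact (hmk _ y).2 rfl
    obtain ⟨w, hw⟩ := h1
    exact ⟨sigmaIncl X _ w, hw⟩
  have hloc : IsLocalDiffeomorph (𝓡 3) (𝓡 3) ∞ F := by
    intro z
    obtain ⟨q, y, rfl⟩ := sigma_cases z
    obtain ⟨Φ, hΦ, hs, ht⟩ := exists_sigmaIncl y
    obtain ⟨Ψ, hΨ, hs', ht'⟩ := exists_openDiffeo (P.isOpenEmb_componentVal q.out)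
    refine ⟨Φ.symm.trans Ψ, ⟨ht ▸ mem_range_self y, hs' ▸ mem_univ _⟩, ?_⟩
    rintro w ⟨hw, -⟩
    have hw' : w ∈ range (sigmaIncl X q) := ht ▸ hw
    obtain ⟨w, rfl⟩ := hw'
    rw [PartialDiffeomorph.trans_apply, hΨ, hF, ← hΦ, Φ.symm_apply_apply (hs ▸ mem_univ _)]
  have : Nonempty (sigma X) := by
    have : (range F).Nonempty := by rw [hsurj]; exact univ_nonempty
    exact range_nonempty_iff_nonempty.1 this
  obtain ⟨Φ, hΦ, hs, ht⟩ := exists_openDiffeo (f := F) ⟨hinj, hloc⟩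
  exact isConnectedSum_of_diffeo Φ.symm (ht.trans hsurj) hs hX

/-- A diffeomorphism onto a union of components identifies components. -/
theorem exists_component_diffeo (Φ : OpenDiffeo A M) (hs : Φ.source = univ)
    (hsat : ∀ x ∈ Φ.target, connectedComponent x ⊆ Φ.target) (y : A) :
    ∃ i : OpenDiffeo (A.component y) (M.component (Φ y)), i.source = univ ∧ i.target = univ := by
  obtain ⟨i, hi, his, hit⟩ := exists_openDiffeo (A.isOpenEmb_componentVal y)
  obtain ⟨j, hj, hjs, hjt⟩ := exists_openDiffeo (M.isOpenEmb_componentVal (Φ y))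
  rw [range_componentVal] at hit hjt
  have hm : ∀ x, x ∈ Φ.source := fun x => hs ▸ mem_univ x
  have hy := Φ.apply_mem (hm y)
  have h1 : Φ '' connectedComponent y ⊆ connectedComponent (Φ y) :=
    (isPreconnected_connectedComponent.image Φ
      (Φ.continuousOn'.mono fun x _ => hm x)).subset_connectedComponent
      ⟨y, mem_connectedComponent, rfl⟩
  have h2 : Φ.symm '' connectedComponent (Φ y) ⊆ connectedComponent y :=
    (isPreconnected_connectedComponent.image Φ.symm
      (Φ.symm.continuousOn'.mono (hsat _ hy))).subset_connectedComponent
      ⟨Φ y, mem_connectedComponent, Φ.symm_apply_apply (hm y)⟩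
  refine ⟨(i.trans Φ).trans j.symm, eq_univ_of_forall fun x => ?_, eq_univ_of_forall fun z => ?_⟩
  · have hx : x ∈ i.source := his ▸ mem_univ x
    refine ⟨⟨hx, hm _⟩, ?_⟩
    change Φ (i x) ∈ j.target
    rw [hjt]
    exact h1 ⟨i x, hit ▸ i.apply_mem hx, rfl⟩
  · have hz : j z ∈ connectedComponent (Φ y) := hjt ▸ j.apply_mem (hjs ▸ mem_univ z)
    rw [PartialDiffeomorph.trans_target', PartialDiffeomorph.trans_target']
    refine ⟨by simp [hjs], hsat _ hy hz, ?_⟩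
    change Φ.symm (j z) ∈ i.target
    rw [hit]
    exact h2 ⟨j z, hz, rfl⟩

theorem isPreconnected_tube (c : Capping M M' ι) (i : ι) : IsPreconnected (c.τ i).target := by
  have h1 : PreconnectedSpace S2 := by
    refine isPreconnected_iff_preconnectedSpace.1 (isPreconnected_sphere ?_ _ _)
    rw [← Module.finrank_eq_rank]
    simp
  rw [PartialDiffeomorph.target_eq_image]
  refine IsPreconnected.image ?_ _ (c.τ i).continuousOn'
  rw [c.τ_source]
  exact isPreconnected_univ.prod isPreconnected_Ioo

/-- The part of the capped off manifold which comes from a subset `C` of `M`. -/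
def cappedPart (c : Capping M M' ι) (C : Set M) : Set M' :=
  c.e '' (C ∩ c.e.source) ∪ ⋃ (i) (_ : (c.τ i).target ⊆ C) (b), (c.φ i b).target

theorem isOpen_cappedPart (c : Capping M M' ι) {C : Set M} (hC : IsOpen C) :
    IsOpen (cappedPart c C) := by
  refine (c.e.isOpen_image (hC.inter c.e.open_source) inter_subset_right).union ?_
  exact isOpen_iUnion fun i => isOpen_iUnion fun _ => isOpen_iUnion fun b => (c.φ i b).open_target

/-- The open caps in the definition show that the set is open; here they are replaced by closed
balls, since their collars already come from `C`. This form is suited to computing complements. -/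
theorem mem_cappedPart_iff (c : Capping M M' ι) {C : Set M} {y : M'} :
    y ∈ cappedPart c C ↔ (∃ x ∈ C, x ∈ c.e.source ∧ c.e x = y) ∨
      ∃ a : ι × Bool, (c.τ a.1).target ⊆ C ∧ y ∈ ballOf (c.φ a.1 a.2) := by
  constructor
  · rintro (⟨x, ⟨hx, hxs⟩, rfl⟩ | hy)
    · exact Or.inl ⟨x, hx, hxs, rfl⟩
    · simp only [mem_iUnion] at hy
      obtain ⟨i, hi, b, hy⟩ := hy
      rcases c.mem_cap_iff.1 hy with h | ⟨v, t, h0, ht, rfl⟩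
      · exact Or.inr ⟨(i, b), hi, h⟩
      · have h1 : |side b * t| < c.δ i := by rwa [abs_side_mul, abs_of_pos h0]
        have h2 : side b * t ≠ 0 := by
          rw [← abs_pos, abs_side_mul]
          exact abs_pos.2 h0.ne'
        exact Or.inl ⟨_, hi (c.mem_tube_iff.2 ⟨v, _, h1, rfl⟩), c.tube_mem_e_source h1 h2, rfl⟩
  · rintro (⟨x, hx, hxs, rfl⟩ | ⟨a, ha, hy⟩)
    · exact Or.inl ⟨x, ⟨hx, hxs⟩, rfl⟩
    · exact Or.inr (mem_iUnion₂.2 ⟨a.1, ha, mem_iUnion.2 ⟨a.2, c.ball_subset _ _ hy⟩⟩)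

theorem tube_subset_or {c : Capping M M' ι} {C : Set M} (hC : IsClopen C) (i : ι) :
    (c.τ i).target ⊆ C ∨ (c.τ i).target ⊆ Cᶜ := by
  by_cases h : ((c.τ i).target ∩ C).Nonempty
  · exact Or.inl ((isPreconnected_tube c i).subset_isClopen hC h)
  · exact Or.inr fun x hx hxC => h ⟨x, hx, hxC⟩

/-- Tubes are connected, so each lies on one side of the clopen set `C`, and its caps go to that
side only. Hence the capped part of a clopen set is closed as well as open, and so a union of
components. -/
theorem cappedPart_compl {c : Capping M M' ι}
    (hd : Pairwise (Function.onFun Disjoint fun i => (c.τ i).target)) {C : Set M}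
    (hC : IsClopen C) : cappedPart c Cᶜ = (cappedPart c C)ᶜ := by
  ext y
  rw [mem_compl_iff, mem_cappedPart_iff, mem_cappedPart_iff]
  have hball : ∀ x ∈ c.e.source, ∀ a : ι × Bool, c.e x ∉ ballOf (c.φ a.1 a.2) := by
    intro x hx a ha
    have := c.e.apply_mem hx
    rw [c.e_target] at this
    exact this (mem_iUnion.2 ⟨a, ha⟩)
  constructor
  · rintro (⟨x, hx, hxs, rfl⟩ | ⟨a, ha, hya⟩) (⟨x', hx', hxs', h⟩ | ⟨b, hb, hyb⟩)
    · exact hx (c.e.injOn' hxs' hxs h ▸ hx')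
    · exact hball x hxs b hyb
    · exact hball x' hxs' a (h ▸ hya)
    · obtain rfl : a = b := by
        by_contra hab
        exact (c.ball_disjoint hd hab).le_bot ⟨hya, hyb⟩
      obtain ⟨x, hx⟩ := nonempty_sphereOf (c.τ a.1)
      exact ha (c.sphere_subset _ hx) (hb (c.sphere_subset _ hx))
  · intro hy
    by_cases hyt : y ∈ c.e.target
    · refine Or.inl ⟨c.e.symm y, fun h => hy (Or.inl ?_), c.e.symm_apply_mem hyt,
        c.e.apply_symm_apply hyt⟩
      exact ⟨_, h, c.e.symm_apply_mem hyt, c.e.apply_symm_apply hyt⟩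
    · rw [c.e_target, notMem_compl_iff] at hyt
      obtain ⟨a, ha⟩ := mem_iUnion.1 hyt
      refine Or.inr ⟨a, (tube_subset_or hC a.1).resolve_left fun h => hy (Or.inr ⟨a, h, ha⟩), ha⟩

/-- Splitting restricts to connected components. -/
theorem Capping.exists_component (c : Capping M M' ι) (x : M) :
    ∃ (B : ThreeManifold.{u}) (j : OpenDiffeo B M') (κ : Type u), Nonempty B ∧ j.source = univ ∧
      (∀ y ∈ j.target, connectedComponent y ⊆ j.target) ∧
      Nonempty (Capping (M.component x) B κ) := by
  obtain ⟨c, hd, -⟩ := c.exists_thin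
  have hC : IsClopen (connectedComponent x) := isClopen_connectedComponent
  set C := connectedComponent x
  have hV : IsClopen (cappedPart c C) := by
    refine ⟨?_, isOpen_cappedPart c hC.isOpen⟩
    rw [← isOpen_compl_iff, ← cappedPart_compl hd hC]
    exact isOpen_cappedPart c hC.compl.isOpen
  have hne : (cappedPart c C).Nonempty := by
    by_cases hx : x ∈ c.e.source
    · exact ⟨c.e x, (mem_cappedPart_iff c).2 (Or.inl ⟨x, mem_connectedComponent, hx, rfl⟩)⟩
    · rw [c.e_source, notMem_compl_iff] at hx
      obtain ⟨i, hi⟩ := mem_iUnion.1 hx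
      have h1 : (c.τ i).target ⊆ C := (tube_subset_or hC i).resolve_right fun h =>
        h (c.sphere_subset i hi) mem_connectedComponent
      exact ⟨_, (mem_cappedPart_iff c).2 (Or.inr ⟨(i, true), h1, 0, by simp, rfl⟩)⟩
  let B := M'.ofOpens ⟨cappedPart c C, hV.isOpen⟩
  have hB : Nonempty B := hne.to_subtype
  obtain ⟨i, -, his, hit⟩ := exists_openDiffeo (M.isOpenEmb_componentVal x)
  obtain ⟨j, -, hjs, hjt⟩ := exists_openDiffeo (M'.isOpenEmb_ofOpens ⟨cappedPart c C, hV.isOpen⟩)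
  rw [range_componentVal] at hit
  replace hjt : j.target = cappedPart c C := hjt.trans Subtype.range_val
  refine ⟨B, j, _, hB, hjs, fun y hy => ?_, ⟨c.pullback i j (fun k => (c.τ k).target ⊆ C) his hjs
    ?_ ?_ ?_ ?_ ?_⟩⟩
  · rw [hjt] at hy ⊢
    exact hV.connectedComponent_subset hy
  · rw [hit]; exact fun k hk => hk
  · intro k hk
    rw [hit]
    have := (tube_subset_or hC k).resolve_left hk
    exact disjoint_left.2 fun y hy => this (c.sphere_subset k hy)
  · intro k b hk y hy
    rw [hjt]
    exact Or.inr (mem_iUnion₂.2 ⟨k, hk, mem_iUnion.2 ⟨b, hy⟩⟩)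
  · intro k b hk
    rw [hjt, disjoint_left]
    intro y hy
    rw [← mem_compl_iff, ← cappedPart_compl hd hC]
    exact (mem_cappedPart_iff c).2 (Or.inr ⟨(k, b), (tube_subset_or hC k).resolve_left hk, hy⟩)
  · intro y hy
    rw [hit, hjt]
    constructor
    · exact fun h => (mem_cappedPart_iff c).2 (Or.inl ⟨y, h, hy, rfl⟩)
    · intro h
      by_contra hyC
      have h1 : c.e y ∈ cappedPart c Cᶜ := (mem_cappedPart_iff c).2 (Or.inl ⟨y, hyC, hy, rfl⟩)
      rw [cappedPart_compl hd hC] at h1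
      exact h1 h

/-- A component of `M` splits into a union of components of `M'`. The kept ones are components of
`N` up to diffeomorphism, and the removed ones are connected sums by definition of the step. -/
theorem IsSurgeryStep.isConnectedSum_component (h : IsSurgeryStep 𝒳 M N)
    (hN : ∀ y : N, IsConnectedSum 𝒳 (N.component y)) (x : M) :
    IsConnectedSum 𝒳 (M.component x) := by
  obtain ⟨M', 𝒮, k, hc, hk, hsat, hrem⟩ := h
  obtain ⟨c⟩ := exists_capping_of_isCappingOff hc
  have hM' : ∀ z : M', IsConnectedSum 𝒳 (M'.component z) := by
    intro z
    by_cases hz : z ∈ range k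
    · obtain ⟨y, rfl⟩ := hz
      have : Nonempty N := ⟨y⟩
      obtain ⟨Φ, rfl, hs, ht⟩ := exists_openDiffeo hk
      obtain ⟨i, his, hit⟩ := exists_component_diffeo Φ hs (by rwa [ht]) y
      exact isConnectedSum_of_diffeo i.symm hit his (hN y)
    · exact hrem z hz
  obtain ⟨B, j, κ, hB, hjs, hjt, ⟨d⟩⟩ := c.exists_component x
  refine d.isConnectedSum (isConnectedSum_of_component fun y => ?_)
  obtain ⟨i, his, hit⟩ := exists_component_diffeo j hjs hjt y
  exact isConnectedSum_of_diffeo i his hit (hM' _)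

end ThreeManifold

end

theorem mainTheorem12
    (𝒳 : Set ThreeManifold.{u}) (h𝒳 : ∀ Y ∈ 𝒳, Y.IsClosedManifold)
    (M : ThreeManifold.{u}) (p : ℕ) (N : Fin (p + 1) → ThreeManifold.{u})
    (hfirst : N 0 = M)
    (hstep : ∀ i : Fin p, ThreeManifold.IsSurgeryStep 𝒳 (N i.castSucc) (N i.succ))
    (hlast : IsEmpty (N (Fin.last p))) :
    ∀ x : M, ThreeManifold.IsConnectedSum 𝒳 (M.component x) := by
  subst hfirst
  -- Downward induction on the index; for the last, empty manifold there is no component to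
  -- consider.
  have key : ∀ i : Fin (p + 1), ∀ x : N i, ThreeManifold.IsConnectedSum 𝒳 ((N i).component x) := by
    intro i
    induction i using Fin.reverseInduction with
    | last => exact fun x => hlast.elim x
    | cast i ih => exact fun x => (hstep i).isConnectedSum_component ih x
  exact key 0
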